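/- Let $p,q\ge 1$. For a probability density $f$ on $\mathbb R^p\times\mathbb R^q$ let $f_1,f_2$ be its marginal densities, $(f_1\otimes f_2)(x,y)=f_1(x)f_2(y)$, and let $P_f$ be the law of an i.i.d. sample $(X_i,Y_i)_{1\le i\le n}$ with common density $f$. For $\lambda\in(0,\infty)^p$ and $\mu\in(0,\infty)^q$ let $$k_\lambda(x,x')=\prod_{i=1}^p\frac{e^{-(x^{(i)}-x'^{(i)})^2/(2\lambda_i^2)}}{\sqrt{2\pi}\,\lambda_i},\qquad l_\mu(y,y')=\prod_{j=1}^q\frac{e^{-(y^{(j)}-y'^{(j)})^2/(2\mu_j^2)}}{\sqrt{2\pi}\,\mu_j},$$ and let $\widehat H_{\lambda,\mu}=\widehat H^{(2)}+\widehat H^{(4)}-2\widehat H^{(3)}$, where $\widehat H^{(2)},\widehat H^{(3)},\widehat H^{(4)}$ are the averages of $k_\lambda(X_i,X_j)\,l_\mu(Y_i,Y_j)$, of $k_\lambda(X_i,X_j)\,l_\mu(Y_j,Y_r)$ and of $k_\lambda(X_i,X_j)\,l_\mu(Y_r,Y_s)$ over all tuples of pairwise distinct indices $(i,j)$, $(i,j,r)$,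 $(i,j,r,s)$ in $\{1,\dots,n\}$ (an average over an empty set of tuples is $0$). For $\alpha\in(0,1)$ let $q^{\lambda,\mu}_{1-\alpha}$ be the $(1-\alpha)$-quantile of $\widehat H_{\lambda,\mu}$ under $P_{f_1\otimes f_2}$, and let $\Delta^{\lambda,\mu}_\alpha=\mathbf 1\{\widehat H_{\lambda,\mu}>q^{\lambda,\mu}_{1-\alpha}\}$. For $\delta,R,R'>0$ let $\mathcal S^\delta_{p+q}(R,R')$ be the class of densities $f$ such that $\max\{\|f\|_\infty,\|f_1\|_\infty,\|f_2\|_\infty\}\le R'$ and such that $\psi=f-f_1\otimes f_2$ is in $\mathbb L_1\cap\mathbb L_2(\mathbb R^{p+q})$ with $$\int_{\mathbb R^{p+q}}\|u\|^{2\delta}\,|\hat\psi(u)|^2\,du\le(2\pi)^{p+q}R^2,\qquad \hat\psi(u)=\int_{\mathbb R^{p+q}}\psi(x)\,e^{i\langle x,u\rangle}\,dx .$$ For a test $\Delta$, a class $\mathcal C$ of densities and $\beta\in(0,1)$, the uniform separation rate is $$\rho(\Delta,\mathcal C,\beta)=\inf\Big\{\rho>0:\ \sup_{f\in\mathcal C,\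 \|f-f_1\otimes f_2\|_2>\rho}P_f(\Delta=0)\le\beta\Big\}.$$ **Corollary 2.2.** Let $\alpha\in(0,1/e)$, $\beta\in(0,1)$ and $\delta,R,R'>0$, and put $\lambda_i^*=\mu_j^*=n^{-2/(4\delta+p+q)}$ for all $1\le i\le p$ and $1\le j\le q$. There is a constant $C=C(p,q,\alpha,\beta,\delta,R,R')>0$ such that for every integer $n>(\log(1/\alpha))^{1+(p+q)/(4\delta)}$, $$\max\Big\{\prod_i\lambda_i^*,\prod_j\mu_j^*\Big\}<1,\qquad n\sqrt{\lambda_1^*\cdots\lambda_p^*\,\mu_1^*\cdots\mu_q^*}>\log(1/\alpha)>1,$$ and $$\rho\big(\Delta_\alpha^{\lambda^*,\mu^*},\mathcal S^\delta_{p+q}(R,R'),\beta\big)\le C\,n^{-2\delta/(4\delta+p+q)} .$$ -/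

import Mathlib

open MeasureTheory
open scoped ENNReal

noncomputable section

namespace HSIC

/-- The space `ℝ^d` with its Euclidean norm and Lebesgue measure. -/
abbrev E (d : ℕ) : Type := EuclideanSpace ℝ (Fin d)

/-- `f` is a probability density with respect to Lebesgue measure on `ℝ^p × ℝ^q`. -/
structure IsDensity {p q : ℕ} (f : E p × E q → ℝ) : Prop where
  measurable : Measurable f
  nonneg : ∀ z, 0 ≤ f z
  lintegral_eq_one : ∫⁻ z, ENNReal.ofReal (f z) = 1

/-- First marginal `f₁(x) = ∫ f(x, y) dy`. -/
def marginalFst {p q : ℕ} (f : E p × E q → ℝ) (x : E p) : ℝ := ∫ y, f (x, y)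

/-- Second marginal `f₂(y) = ∫ f(x, y) dx`. -/
def marginalSnd {p q : ℕ} (f : E p × E q → ℝ) (y : E q) : ℝ := ∫ x, f (x, y)

/-- The product of the marginals, `(f₁ ⊗ f₂)(x, y) = f₁(x) f₂(y)`. -/
def prodMarginals {p q : ℕ} (f : E p × E q → ℝ) (z : E p × E q) : ℝ :=
  marginalFst f z.1 * marginalSnd f z.2

/-- The difference `ψ = f - f₁ ⊗ f₂`. -/
def dependence {p q : ℕ} (f : E p × E q → ℝ) (z : E p × E q) : ℝ :=
  f z - prodMarginals f z

/-- `P_f`: the law of `n` independent observations with common density `f`. -/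
def sampleLaw {p q : ℕ} (n : ℕ) (f : E p × E q → ℝ) : Measure (Fin n → E p × E q) :=
  Measure.pi fun _ => volume.withDensity fun z => ENNReal.ofReal (f z)

/-- The density `g_d` of the standard Gaussian distribution on `ℝ^d`. -/
def stdGaussian {d : ℕ} (x : E d) : ℝ :=
  1 / (2 * Real.pi) ^ ((d : ℝ) / 2) * Real.exp (-(1 / 2) * ∑ i, x i ^ 2)

/-- The rescaled Gaussian density with bandwidths `b₁, …, b_d`. -/
def scaledGaussian {d : ℕ} (b : Fin d → ℝ) (x : E d) : ℝ :=
  1 / (∏ i, b i) * stdGaussian (WithLp.toLp 2 fun i => x i / b i)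

/-- The Gaussian kernel with bandwidths `b₁, …, b_d`. -/
def gaussKernel {d : ℕ} (b : Fin d → ℝ) (x x' : E d) : ℝ := scaledGaussian b (x - x')

/-- The U-statistic of order 2. An embedding `Fin r ↪ Fin n` is an `r`-tuple drawn without
replacement from the `n` indices. -/
def ustat2 {p q n : ℕ} (lam : Fin p → ℝ) (mu : Fin q → ℝ) (z : Fin n → E p × E q) : ℝ :=
  1 / ((n : ℝ) * ((n : ℝ) - 1)) *
    ∑ i : Fin 2 ↪ Fin n,
      gaussKernel lam (z (i 0)).1 (z (i 1)).1 * gaussKernel mu (z (i 0)).2 (z (i 1)).2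

/-- The U-statistic of order 3. -/
def ustat3 {p q n : ℕ} (lam : Fin p → ℝ) (mu : Fin q → ℝ) (z : Fin n → E p × E q) : ℝ :=
  1 / ((n : ℝ) * ((n : ℝ) - 1) * ((n : ℝ) - 2)) *
    ∑ i : Fin 3 ↪ Fin n,
      gaussKernel lam (z (i 0)).1 (z (i 1)).1 * gaussKernel mu (z (i 1)).2 (z (i 2)).2

/-- The U-statistic of order 4. -/
def ustat4 {p q n : ℕ} (lam : Fin p → ℝ) (mu : Fin q → ℝ) (z : Fin n → E p × E q) : ℝ :=
  1 / ((n : ℝ) * ((n : ℝ) - 1) * ((n : ℝ) - 2) * ((n : ℝ) - 3)) *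
    ∑ i : Fin 4 ↪ Fin n,
      gaussKernel lam (z (i 0)).1 (z (i 1)).1 * gaussKernel mu (z (i 2)).2 (z (i 3)).2

/-- The estimator of the HSIC measure, as a function of the sample. -/
def hsicStat {p q n : ℕ} (lam : Fin p → ℝ) (mu : Fin q → ℝ) (z : Fin n → E p × E q) : ℝ :=
  ustat2 lam mu z + ustat4 lam mu z - 2 * ustat3 lam mu z

/-- The `(1 - α)`-quantile of the HSIC statistic under `P_{f₁ ⊗ f₂}`, that is, the infimum of the
real `t` at which the distribution function is at least `1 - α`. -/
def nullQuantile {p q : ℕ} (n : ℕ) (lam : Fin p → ℝ) (mu : Fin q → ℝ) (α : ℝ)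
    (f : E p × E q → ℝ) : ℝ :=
  sInf {t : ℝ | ENNReal.ofReal (1 - α) ≤
    sampleLaw n (prodMarginals f) {z | hsicStat lam mu z ≤ t}}

/-- The theoretical single test: `1` (rejection) when the HSIC statistic exceeds its quantile under
`P_{f₁ ⊗ f₂}`, and `0` otherwise. The critical value depends on the marginals of `f`. -/
def hsicTest {p q : ℕ} (n : ℕ) (lam : Fin p → ℝ) (mu : Fin q → ℝ) (α : ℝ)
    (f : E p × E q → ℝ) (z : Fin n → E p × E q) : ℕ :=
  Set.indicator {w | nullQuantile n lam mu α f < hsicStat lam mu w} (fun _ => 1) z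

/-- The condition on the bandwidths, the sample size and the level:
`max {∏ λ_i, ∏ μ_j} < 1` and `n √(λ₁ ⋯ λ_p μ₁ ⋯ μ_q) > log (1/α) > 1`. -/
def BandwidthCondition {p q : ℕ} (n : ℕ) (lam : Fin p → ℝ) (mu : Fin q → ℝ) (α : ℝ) : Prop :=
  max (∏ i, lam i) (∏ j, mu j) < 1 ∧
  Real.log (1 / α) < n * Real.sqrt ((∏ i, lam i) * ∏ j, mu j) ∧
  1 < Real.log (1 / α)

/-- The Fourier transform `ŝ(u) = ∫ s(x) exp(i⟨x, u⟩) dx`. -/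
def fourierHat {d : ℕ} (s : E d → ℝ) (u : E d) : ℂ :=
  ∫ x, (s x : ℂ) * Complex.exp (Complex.I * ((inner ℝ x u : ℝ) : ℂ))

/-- The Sobolev ball of regularity `δ` and radius `R` in dimension `d`. The integral is a Lebesgue
integral with values in `[0, ∞]`. -/
def sobolevBall (d : ℕ) (δ R : ℝ) : Set (E d → ℝ) :=
  {s | MemLp s 1 volume ∧ MemLp s 2 volume ∧
    ∫⁻ u, ENNReal.ofReal (‖u‖ ^ (2 * δ) * ‖fourierHat s u‖ ^ 2) ≤
      ENNReal.ofReal ((2 * Real.pi) ^ d * R ^ 2)}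

/-- The functions `f` for which `f - f₁ ⊗ f₂`, seen as a function on `ℝ^(p+q)`, belongs to the
Sobolev ball, and `max {‖f‖_∞, ‖f₁‖_∞, ‖f₂‖_∞} ≤ R'`. -/
def sobolevClass (p q : ℕ) (δ R R' : ℝ) : Set (E p × E q → ℝ) :=
  {f | (fun w : E (p + q) => dependence f (EuclideanSpace.finAddEquivProd w)) ∈
      sobolevBall (p + q) δ R ∧
    max (eLpNorm f ∞ volume)
      (max (eLpNorm (marginalFst f) ∞ volume) (eLpNorm (marginalSnd f) ∞ volume)) ≤
        ENNReal.ofReal R'}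

/-- The alternatives at `L²` distance more than `r` from independence: densities `f` in the class
`𝒞` with `‖f - f₁ ⊗ f₂‖₂ > r`. -/
def alternatives {p q : ℕ} (𝒞 : Set (E p × E q → ℝ)) (r : ℝ) : Set (E p × E q → ℝ) :=
  {f | IsDensity f ∧ f ∈ 𝒞 ∧ ENNReal.ofReal r < eLpNorm (dependence f) 2 volume}

/-- The uniform separation rate of a test `Δ` over the class `𝒞`: the infimum of the `r > 0` such
that the error of the second kind is at most `β`, uniformly over the alternatives at distance more
than `r`. It takes values in `[0, ∞]`, so that it is `∞` when there is no such `r`. -/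
def separationRate {p q n : ℕ} (Δ : (E p × E q → ℝ) → (Fin n → E p × E q) → ℕ)
    (𝒞 : Set (E p × E q → ℝ)) (β : ℝ) : ℝ≥0∞ :=
  ⨅ (r : ℝ) (_ : 0 < r)
    (_ : (⨆ f ∈ alternatives 𝒞 r, sampleLaw n f {z | Δ f z = 0}) ≤ ENNReal.ofReal β),
    ENNReal.ofReal r

/-- The bandwidth `n^(-2/(4δ+p+q))`. -/
def optBandwidth (p q n : ℕ) (δ : ℝ) : ℝ := (n : ℝ) ^ (-2 / (4 * δ + p + q))

end HSIC

end

/-! Write ψ = f − f₁ ⊗ f₂, d = p + q, h for the common bandwidth, k for the Gaussian density on ℝ^d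
with standard deviation h, θ = ⟨ψ, k ∗ ψ⟩ and N = n h^(d/2). For n ≥ 4 the statistic H is an
unbiased estimator of θ, and θ = 0 under independence. Only second moments are used: Chebyshev's
inequality bounds both the critical value and the error of the second kind, so the constants are
powers of 1/α and 1/β.

Variance. H is the U-statistic of order four with kernel w = `quadKernel`, a function of two pairs
of observations. As in Hoeffding's argument, it is an average over permutations of two-sample
U-statistics with m = ⌊n/4⌋ pairs in each sample, and by convexity its mean squared error is at most
that of a single one: (2/m) E g² + m⁻² E w², with g the conditional expectation of w given one pair.
Here g is a combination of values of k ∗ ψ. The Fourier multiplier of k lies in [0, 1], hence ‖k ∗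
ψ‖² ≤ θ, and bounded densities give E g² ≲ θ and E w² ≲ h^(-d). This is
`IsDensity.integral_sq_hsicStat_sub_le`: a variance of order θ/m + 1/(m² h^d). At θ = 0 it shows
that the critical value is at most a/N.

Bias. Splitting frequencies at 1/h gives ‖ψ‖² ≤ e^(1/2) θ + h^(2δ) R² on the Sobolev ball
(`integral_sq_le_of_mem_sobolevBall`). No smoothness of f itself is needed, only of ψ.

Balance. The bandwidth n^(-2/(4δ+d)) is the one with h^(2δ) = 1/N. Then ‖ψ‖² > S/N forces θ ≥ B/N,
and for B large the gap between θ and the critical value exceeds the standard deviation by the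
factor that β requires. The rate is the square root of 1/N. For n < 4 the constant is chosen so
large that there are no alternatives. -/

namespace HSIC

/-! ### The HSIC statistic as a U-statistic of order four -/

/-- Averaging a function of `r` distinct coordinates over all permutations of the indices amounts
to averaging it over all `r`-tuples of distinct indices. -/
lemma perm_average_eq_embedding_average {r n : ℕ} (F : (Fin r → Fin n) → ℝ)
    (ι : Fin r ↪ Fin n) :
    (n.factorial : ℝ)⁻¹ * ∑ σ : Equiv.Perm (Fin n), F (fun j => σ (ι j)) =
      ((n.descFactorial r : ℕ) : ℝ)⁻¹ * ∑ i : Fin r ↪ Fin n, F i := by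
  classical
  -- Permutations act transitively on tuples of distinct indices, so the sum does not depend on the
  -- tuple. Summing it over all tuples and exchanging the two sums then gives the identity by double
  -- counting.
  have key : ∀ ι' : Fin r ↪ Fin n, ∑ σ : Equiv.Perm (Fin n), F (fun j => σ (ι' j)) =
      ∑ σ : Equiv.Perm (Fin n), F (fun j => σ (ι j)) := by
    intro ι'
    obtain ⟨τ, hτ⟩ := (Equiv.Perm.isMultiplyPretransitive (Fin n) r).exists_smul_eq ι ι'
    rw [← Equiv.sum_comp (Equiv.mulRight τ) fun σ => F (fun j => σ (ι j))]
    refine Finset.sum_congr rfl fun σ _ => ?_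
    congr 1
    ext j
    simp [← hτ]
  have hcard : (Fintype.card (Fin r ↪ Fin n) : ℝ) = n.descFactorial r := by
    simp [Fintype.card_embedding_eq]
  have h1 : ∑ ι' : Fin r ↪ Fin n, ∑ σ : Equiv.Perm (Fin n), F (fun j => σ (ι' j)) =
      (n.descFactorial r : ℝ) * ∑ σ : Equiv.Perm (Fin n), F (fun j => σ (ι j)) := by
    rw [Finset.sum_congr rfl fun ι' _ => key ι', Finset.sum_const, Finset.card_univ,
      nsmul_eq_mul, hcard]
  have h2 : ∑ ι' : Fin r ↪ Fin n, ∑ σ : Equiv.Perm (Fin n), F (fun j => σ (ι' j)) =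
      (n.factorial : ℝ) * ∑ i : Fin r ↪ Fin n, F i := by
    rw [Finset.sum_comm]
    have : ∀ σ : Equiv.Perm (Fin n), ∑ ι' : Fin r ↪ Fin n, F (fun j => σ (ι' j)) =
        ∑ i : Fin r ↪ Fin n, F i := fun σ =>
      Equiv.sum_comp (Equiv.embeddingCongr (Equiv.refl (Fin r)) σ) fun i : Fin r ↪ Fin n => F i
    rw [Finset.sum_congr rfl fun σ _ => this σ, Finset.sum_const, Finset.card_univ,
      nsmul_eq_mul, Fintype.card_perm, Fintype.card_fin]
  have hr : r ≤ n := by simpa using Fintype.card_le_of_embedding ι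
  have h3 : (n.descFactorial r : ℝ) ≠ 0 := by
    exact_mod_cast (Nat.pos_of_ne_zero (by simp [Nat.descFactorial_eq_zero_iff_lt]; omega)).ne'
  have h4 : (n.factorial : ℝ) ≠ 0 := by exact_mod_cast n.factorial_ne_zero
  rw [h1] at h2
  field_simp
  linarith

/-- The kernel of order four whose U-statistic is the HSIC statistic, as a function of two pairs
of observations. -/
noncomputable def quadKernel {X Y : Type*} (K : X → X → ℝ) (L : Y → Y → ℝ)
    (a b : (X × Y) × (X × Y)) : ℝ :=
  1 / 4 * (K a.1.1 b.1.1 - K a.1.1 b.2.1 - K a.2.1 b.1.1 + K a.2.1 b.2.1) *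
    (L a.1.2 b.1.2 - L a.1.2 b.2.2 - L a.2.2 b.1.2 + L a.2.2 b.2.2)

lemma gaussKernel_comm {d : ℕ} (b : Fin d → ℝ) (x y : E d) :
    gaussKernel b x y = gaussKernel b y x := by
  simp only [gaussKernel, scaledGaussian, stdGaussian]
  congr 4
  refine Finset.sum_congr rfl fun i _ => ?_
  simp only [PiLp.sub_apply, div_pow]
  ring

section average

variable {p q n : ℕ} (lam : Fin p → ℝ) (mu : Fin q → ℝ) (z : Fin n → E p × E q)

/-- Any fixed distinct indices may carry the average. This freedom lets every term in the expansion
of `quadKernel` be recognised as a term of one of the three U-statistics. -/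
lemma perm_average_eq_ustat2 (i j : Fin n) (hij : i ≠ j) :
    (n.factorial : ℝ)⁻¹ * ∑ σ : Equiv.Perm (Fin n),
      gaussKernel lam (z (σ i)).1 (z (σ j)).1 * gaussKernel mu (z (σ i)).2 (z (σ j)).2 =
      ustat2 lam mu z := by
  have h := perm_average_eq_embedding_average
    (fun s : Fin 2 → Fin n =>
      gaussKernel lam (z (s 0)).1 (z (s 1)).1 * gaussKernel mu (z (s 0)).2 (z (s 1)).2)
    ⟨![i, j], by
      intro a b hab
      fin_cases a <;> fin_cases b <;> simp_all [eq_comm]⟩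
  have hn : 2 ≤ n := by have := i.2; have := j.2; have := Fin.val_ne_of_ne hij; omega
  have hc : ((n.descFactorial 2 : ℕ) : ℝ) = (n : ℝ) * ((n : ℝ) - 1) := by
    rw [Nat.cast_descFactorial_two]
  rw [hc] at h
  rw [ustat2, one_div]
  exact h

lemma perm_average_eq_ustat3 (i j k : Fin n) (hij : i ≠ j) (hik : i ≠ k) (hjk : j ≠ k) :
    (n.factorial : ℝ)⁻¹ * ∑ σ : Equiv.Perm (Fin n),
      gaussKernel lam (z (σ i)).1 (z (σ j)).1 * gaussKernel mu (z (σ j)).2 (z (σ k)).2 =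
      ustat3 lam mu z := by
  have h := perm_average_eq_embedding_average
    (fun s : Fin 3 → Fin n =>
      gaussKernel lam (z (s 0)).1 (z (s 1)).1 * gaussKernel mu (z (s 1)).2 (z (s 2)).2)
    ⟨![i, j, k], by
      intro a b hab
      fin_cases a <;> fin_cases b <;> simp_all [eq_comm]⟩
  have hn : 3 ≤ n := by
    have := i.2; have := j.2; have := k.2; have := Fin.val_ne_of_ne hij
    have := Fin.val_ne_of_ne hik; have := Fin.val_ne_of_ne hjk; omega
  have hc : ((n.descFactorial 3 : ℕ) : ℝ) = (n : ℝ) * ((n : ℝ) - 1) * ((n : ℝ) - 2) := by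
    simp only [Nat.descFactorial_succ, Nat.descFactorial_zero, Nat.sub_zero]
    push_cast [Nat.cast_sub (show 1 ≤ n by omega), Nat.cast_sub (show 2 ≤ n by omega)]
    ring
  rw [hc] at h
  rw [ustat3, one_div]
  exact h

lemma perm_average_eq_ustat4 (i j k l : Fin n) (hij : i ≠ j) (hik : i ≠ k) (hil : i ≠ l)
    (hjk : j ≠ k) (hjl : j ≠ l) (hkl : k ≠ l) :
    (n.factorial : ℝ)⁻¹ * ∑ σ : Equiv.Perm (Fin n),
      gaussKernel lam (z (σ i)).1 (z (σ j)).1 * gaussKernel mu (z (σ k)).2 (z (σ l)).2 =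
      ustat4 lam mu z := by
  have h := perm_average_eq_embedding_average
    (fun s : Fin 4 → Fin n =>
      gaussKernel lam (z (s 0)).1 (z (s 1)).1 * gaussKernel mu (z (s 2)).2 (z (s 3)).2)
    ⟨![i, j, k, l], by
      intro a b hab
      fin_cases a <;> fin_cases b <;> simp_all [eq_comm]⟩
  have hn : 4 ≤ n := by
    have := i.2; have := j.2; have := k.2; have := l.2; have := Fin.val_ne_of_ne hij
    have := Fin.val_ne_of_ne hik; have := Fin.val_ne_of_ne hjk; have := Fin.val_ne_of_ne hil
    have := Fin.val_ne_of_ne hjl; have := Fin.val_ne_of_ne hkl; omega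
  have hc : ((n.descFactorial 4 : ℕ) : ℝ) =
      (n : ℝ) * ((n : ℝ) - 1) * ((n : ℝ) - 2) * ((n : ℝ) - 3) := by
    simp only [Nat.descFactorial_succ, Nat.descFactorial_zero, Nat.sub_zero]
    push_cast [Nat.cast_sub (show 1 ≤ n by omega), Nat.cast_sub (show 2 ≤ n by omega),
      Nat.cast_sub (show 3 ≤ n by omega)]
    ring
  rw [hc] at h
  rw [ustat4, one_div]
  exact h

/-- The HSIC statistic is the U-statistic with kernel `quadKernel`. -/
lemma hsicStat_eq_perm_average_quadKernel (i j k l : Fin n) (hij : i ≠ j) (hik : i ≠ k)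
    (hil : i ≠ l) (hjk : j ≠ k) (hjl : j ≠ l) (hkl : k ≠ l) :
    hsicStat lam mu z = (n.factorial : ℝ)⁻¹ * ∑ σ : Equiv.Perm (Fin n),
      quadKernel (gaussKernel lam) (gaussKernel mu)
        (z (σ i), z (σ j)) (z (σ k), z (σ l)) := by
  have e2 := perm_average_eq_ustat2 lam mu z
  have e3 := perm_average_eq_ustat3 lam mu z
  have e4 := perm_average_eq_ustat4 lam mu z
  have hK := gaussKernel_comm lam
  have hL := gaussKernel_comm mu
  -- Of the sixteen products, four have the same index pair in both kernels (order 2), four have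
  -- disjoint pairs (order 4), both with sign +, and eight share one index (order 3), with sign −.
  -- Arguments are flipped so that a shared index stands where `ustat3` has it.
  have expand : ∀ σ : Equiv.Perm (Fin n),
      quadKernel (gaussKernel lam) (gaussKernel mu) (z (σ i), z (σ j)) (z (σ k), z (σ l)) =
      1 / 4 * (
        (gaussKernel lam (z (σ i)).1 (z (σ k)).1 * gaussKernel mu (z (σ i)).2 (z (σ k)).2
        - gaussKernel lam (z (σ k)).1 (z (σ i)).1 * gaussKernel mu (z (σ i)).2 (z (σ l)).2
        - gaussKernel lam (z (σ i)).1 (z (σ k)).1 * gaussKernel mu (z (σ k)).2 (z (σ j)).2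
        + gaussKernel lam (z (σ i)).1 (z (σ k)).1 * gaussKernel mu (z (σ j)).2 (z (σ l)).2)
        - (gaussKernel lam (z (σ l)).1 (z (σ i)).1 * gaussKernel mu (z (σ i)).2 (z (σ k)).2
        - gaussKernel lam (z (σ i)).1 (z (σ l)).1 * gaussKernel mu (z (σ i)).2 (z (σ l)).2
        - gaussKernel lam (z (σ i)).1 (z (σ l)).1 * gaussKernel mu (z (σ j)).2 (z (σ k)).2
        + gaussKernel lam (z (σ i)).1 (z (σ l)).1 * gaussKernel mu (z (σ l)).2 (z (σ j)).2)
        - (gaussKernel lam (z (σ j)).1 (z (σ k)).1 * gaussKernel mu (z (σ k)).2 (z (σ i)).2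
        - gaussKernel lam (z (σ j)).1 (z (σ k)).1 * gaussKernel mu (z (σ i)).2 (z (σ l)).2
        - gaussKernel lam (z (σ j)).1 (z (σ k)).1 * gaussKernel mu (z (σ j)).2 (z (σ k)).2
        + gaussKernel lam (z (σ k)).1 (z (σ j)).1 * gaussKernel mu (z (σ j)).2 (z (σ l)).2)
        + (gaussKernel lam (z (σ j)).1 (z (σ l)).1 * gaussKernel mu (z (σ i)).2 (z (σ k)).2
        - gaussKernel lam (z (σ j)).1 (z (σ l)).1 * gaussKernel mu (z (σ l)).2 (z (σ i)).2
        - gaussKernel lam (z (σ l)).1 (z (σ j)).1 * gaussKernel mu (z (σ j)).2 (z (σ k)).2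
        + gaussKernel lam (z (σ j)).1 (z (σ l)).1 * gaussKernel mu (z (σ j)).2 (z (σ l)).2)) := by
    intro σ
    rw [hK (z (σ k)).1 (z (σ i)).1, hK (z (σ l)).1 (z (σ i)).1, hK (z (σ k)).1 (z (σ j)).1,
      hK (z (σ l)).1 (z (σ j)).1, hL (z (σ k)).2 (z (σ j)).2, hL (z (σ l)).2 (z (σ j)).2,
      hL (z (σ k)).2 (z (σ i)).2, hL (z (σ l)).2 (z (σ i)).2]
    simp only [quadKernel]
    ring
  rw [Finset.sum_congr rfl fun σ _ => expand σ, ← Finset.mul_sum]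
  simp only [Finset.sum_add_distrib, Finset.sum_sub_distrib]
  rw [mul_left_comm]
  simp only [mul_add, mul_sub]
  rw [e2 i k hik, e3 k i l hik.symm hkl hil, e3 i k j hik hij hjk.symm,
    e4 i k j l hik hij hil hjk.symm hkl hjl, e3 l i k hil.symm hkl.symm hik, e2 i l hil,
    e4 i l j k hil hij hik hjl.symm hkl.symm hjk, e3 i l j hil hij hjl.symm,
    e3 j k i hjk hij.symm hik.symm, e4 j k i l hjk hij.symm hjl hik.symm hkl hil, e2 j k hjk,
    e3 k j l hjk.symm hkl hjl, e4 j l i k hjl hij.symm hjk hil.symm hkl.symm hik,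
    e3 j l i hjl hij.symm hil.symm, e3 l j k hjl.symm hkl.symm hjk, e2 j l hjl, hsicStat]
  ring

end average

/-! ### Mean squared error of empirical means and of two-sample U-statistics -/

lemma integrable_of_abs_le {S : Type*} [MeasurableSpace S] {P : Measure S} [IsFiniteMeasure P]
    {φ : S → ℝ} {B : ℝ} (hφ : Measurable φ) (hB : ∀ s, |φ s| ≤ B) : Integrable φ P :=
  Integrable.of_bound hφ.aestronglyMeasurable B (Filter.Eventually.of_forall hB)

lemma abs_integral_le {S : Type*} [MeasurableSpace S] {P : Measure S} [IsProbabilityMeasure P]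
    {φ : S → ℝ} {B : ℝ} (hB : ∀ s, |φ s| ≤ B) : |∫ s, φ s ∂P| ≤ B := by
  refine (norm_integral_le_of_norm_le_const (f := φ) (C := B)
    (Filter.Eventually.of_forall hB)).trans ?_
  simp

lemma abs_average_le {m : ℕ} (hm : 0 < m) {u : Fin m → ℝ} {B : ℝ} (hB : ∀ a, |u a| ≤ B) :
    |(m : ℝ)⁻¹ * ∑ a, u a| ≤ B := by
  have hm' : (0 : ℝ) < m := by exact_mod_cast hm
  rw [abs_mul, abs_of_pos (inv_pos.2 hm'), inv_mul_le_iff₀ hm']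
  refine (Finset.abs_sum_le_sum_abs _ _).trans ?_
  calc ∑ a, |u a| ≤ ∑ _a : Fin m, B := Finset.sum_le_sum fun a _ => hB a
    _ = m * B := by simp

/-- The mean squared deviation of an empirical mean from a constant. -/
lemma integral_sq_average_sub_le {S : Type*} [MeasurableSpace S] (P : Measure S)
    [IsProbabilityMeasure P] {m : ℕ} (hm : 0 < m) {φ : S → ℝ} {B : ℝ} (hφ : Measurable φ)
    (hB : ∀ s, |φ s| ≤ B) (t : ℝ) :
    ∫ x, ((m : ℝ)⁻¹ * ∑ a, φ (x a) - t) ^ 2 ∂(Measure.pi fun _ : Fin m => P) ≤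
      (m : ℝ)⁻¹ * ∫ s, φ s ^ 2 ∂P + (∫ s, φ s ∂P - t) ^ 2 := by
  have hm' : (0 : ℝ) < m := by exact_mod_cast hm
  set Q := Measure.pi fun _ : Fin m => P
  have hmeas : Measurable fun x : Fin m → S => (m : ℝ)⁻¹ * ∑ a, φ (x a) := by fun_prop
  have hbd : ∀ x : Fin m → S, |(m : ℝ)⁻¹ * ∑ a, φ (x a)| ≤ B := fun x =>
    abs_average_le hm fun a => hB _
  have hL2 : MemLp (fun x : Fin m → S => (m : ℝ)⁻¹ * ∑ a, φ (x a) - t) 2 Q :=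
    (MemLp.of_bound hmeas.aestronglyMeasurable B (Filter.Eventually.of_forall hbd)).sub
      (memLp_const t)
  have hφ2 : MemLp φ 2 P :=
    MemLp.of_bound hφ.aestronglyMeasurable B (Filter.Eventually.of_forall hB)
  have hmean : ∫ x, ((m : ℝ)⁻¹ * ∑ a, φ (x a) - t) ∂Q = ∫ s, φ s ∂P - t := by
    rw [integral_sub (integrable_of_abs_le hmeas hbd) (integrable_const _), integral_const_mul,
      integral_finsetSum]
    · have : ∀ a : Fin m, ∫ x, φ (x a) ∂Q = ∫ s, φ s ∂P := fun a => by
        rw [← (measurePreserving_eval (fun _ : Fin m => P) a).map_eq,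
          integral_map (measurable_pi_apply a).aemeasurable hφ.aestronglyMeasurable]
      simp only [this]
      simp
      field_simp
    · exact fun a _ => integrable_of_abs_le (B := B) (by fun_prop) fun x => hB _
  have hvar : ProbabilityTheory.variance (fun x : Fin m → S => (m : ℝ)⁻¹ * ∑ a, φ (x a) - t) Q ≤
      (m : ℝ)⁻¹ * ∫ s, φ s ^ 2 ∂P := by
    rw [ProbabilityTheory.variance_sub_const hmeas.aestronglyMeasurable,
      ProbabilityTheory.variance_const_mul]
    have h := ProbabilityTheory.variance_sum_pi (μ := fun _ : Fin m => P) (X := fun _ => φ)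
      fun _ => hφ2
    have h' : (∑ i : Fin m, fun ω : Fin m → S => φ (ω i)) = fun x : Fin m → S => ∑ a, φ (x a) := by
      ext x
      simp
    rw [h'] at h
    rw [h]
    simp only [Finset.sum_const, Finset.card_univ, Fintype.card_fin, nsmul_eq_mul]
    have hv := ProbabilityTheory.variance_le_expectation_sq (μ := P) hφ.aestronglyMeasurable
    simp only [Pi.pow_apply] at hv
    calc ((m : ℝ)⁻¹) ^ 2 * (m * ProbabilityTheory.variance φ P) =
        (m : ℝ)⁻¹ * ProbabilityTheory.variance φ P := by field_simp
      _ ≤ _ := by gcongr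
  rw [ProbabilityTheory.variance_eq_sub hL2, hmean] at hvar
  simp only [Pi.pow_apply] at hvar
  linarith

/-- The mean squared error of a two-sample U-statistic with `m` observations in each sample. -/
lemma integral_sq_two_sample_le {S T : Type*} [MeasurableSpace S] [MeasurableSpace T]
    (P : Measure S) [IsProbabilityMeasure P] (Q : Measure T) [IsProbabilityMeasure Q] {m : ℕ}
    (hm : 0 < m) {w : S → T → ℝ} {B : ℝ} (hw : Measurable (Function.uncurry w))
    (hB : ∀ s t, |w s t| ≤ B) :
    ∫ z, ((m : ℝ)⁻¹ * ∑ b, (m : ℝ)⁻¹ * ∑ a, w (z.1 a) (z.2 b) - ∫ s, ∫ t, w s t ∂Q ∂P) ^ 2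
        ∂((Measure.pi fun _ : Fin m => P).prod (Measure.pi fun _ : Fin m => Q)) ≤
      (m : ℝ)⁻¹ * ∫ s, (∫ t, w s t ∂Q) ^ 2 ∂P + (m : ℝ)⁻¹ * ∫ t, (∫ s, w s t ∂P) ^ 2 ∂Q +
        (m : ℝ)⁻¹ ^ 2 * ∫ s, ∫ t, w s t ^ 2 ∂Q ∂P := by
  have hm' : (0 : ℝ) < m := by exact_mod_cast hm
  set P' := Measure.pi fun _ : Fin m => P
  set Q' := Measure.pi fun _ : Fin m => Q
  set θ := ∫ s, ∫ t, w s t ∂Q ∂P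
  set g : S → ℝ := fun s => ∫ t, w s t ∂Q
  have hwl : ∀ s, Measurable (w s) := fun s => hw.comp measurable_prodMk_left
  have hwr : ∀ t, Measurable fun s => w s t := fun t => hw.comp measurable_prodMk_right
  have hg : Measurable g := (hw.stronglyMeasurable.integral_prod_right').measurable
  have hgB : ∀ s, |g s| ≤ B := fun s => abs_integral_le (hB s)
  have sq_le : ∀ {u : ℝ}, |u| ≤ B → |u ^ 2| ≤ B ^ 2 := fun {u} hu => by
    rw [abs_pow]; gcongr
  have hFB : ∀ (x : Fin m → S) t, |(m : ℝ)⁻¹ * ∑ a, w (x a) t| ≤ B := fun x t =>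
    abs_average_le hm fun a => hB _ _
  have hW : Measurable fun z : (Fin m → S) × (Fin m → T) =>
      (m : ℝ)⁻¹ * ∑ b, (m : ℝ)⁻¹ * ∑ a, w (z.1 a) (z.2 b) := by
    refine Measurable.const_mul (Finset.measurable_fun_sum _ fun b _ => Measurable.const_mul
      (Finset.measurable_fun_sum _ fun a _ => ?_) _) _
    exact hw.comp (g := Function.uncurry w) (f := fun z : (Fin m → S) × (Fin m → T) =>
      (z.1 a, z.2 b)) (by fun_prop)
  have hWB : ∀ z : (Fin m → S) × (Fin m → T),
      |(m : ℝ)⁻¹ * ∑ b, (m : ℝ)⁻¹ * ∑ a, w (z.1 a) (z.2 b) - θ| ≤ B + |θ| := fun z =>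
    (abs_sub _ _).trans (by gcongr; exact abs_average_le hm fun b => hFB _ _)
  have hWi : Integrable (fun z : (Fin m → S) × (Fin m → T) =>
      ((m : ℝ)⁻¹ * ∑ b, (m : ℝ)⁻¹ * ∑ a, w (z.1 a) (z.2 b) - θ) ^ 2) (P'.prod Q') := by
    refine integrable_of_abs_le (B := (B + |θ|) ^ 2) ((hW.sub_const _).pow_const 2) fun z => ?_
    rw [abs_pow]
    gcongr
    exact hWB z
  have hFm : Measurable fun z : (Fin m → S) × T => (m : ℝ)⁻¹ * ∑ a, w (z.1 a) z.2 := by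
    refine Measurable.const_mul (Finset.measurable_fun_sum _ fun a _ => ?_) _
    exact hw.comp (g := Function.uncurry w) (f := fun z : (Fin m → S) × T =>
      (z.1 a, z.2)) (by fun_prop)
  have hF2 : Integrable (fun z : (Fin m → S) × T => ((m : ℝ)⁻¹ * ∑ a, w (z.1 a) z.2) ^ 2)
      (P'.prod Q) :=
    integrable_of_abs_le (hFm.pow_const 2) fun z => sq_le (hFB z.1 z.2)
  have hcx : ∀ x : Fin m → S, ∫ t, (m : ℝ)⁻¹ * ∑ a, w (x a) t ∂Q = (m : ℝ)⁻¹ * ∑ a, g (x a) := by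
    intro x
    rw [integral_const_mul, integral_finsetSum]
    exact fun a _ => integrable_of_abs_le (hwl _) (hB _)
  have hgavg : Integrable (fun x : Fin m → S => ((m : ℝ)⁻¹ * ∑ a, g (x a) - θ) ^ 2) P' := by
    refine integrable_of_abs_le (B := (B + |θ|) ^ 2) (by fun_prop) fun x => ?_
    rw [abs_pow]
    gcongr
    exact (abs_sub _ _).trans (by gcongr; exact abs_average_le hm fun a => hgB _)
  have hw2 : Integrable (fun z : S × T => w z.1 z.2 ^ 2) (P.prod Q) :=
    integrable_of_abs_le (hw.pow_const 2) fun z => sq_le (hB z.1 z.2)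
  have hg' : Measurable fun t => ∫ s, w s t ∂P :=
    (hw.stronglyMeasurable.integral_prod_left').measurable
  have hg'B : ∀ t, |∫ s, w s t ∂P| ≤ B := fun t => abs_integral_le fun s => hB s t
  rw [integral_prod _ hWi]
  -- The estimate for empirical means is used three times: on the second sample with the first one
  -- frozen; on the average of g over the first sample, whose mean is θ; and, for fixed t, on the
  -- first sample with centre 0, which splits the remaining second moment.
  calc ∫ x, ∫ y, ((m : ℝ)⁻¹ * ∑ b, (m : ℝ)⁻¹ * ∑ a, w (x a) (y b) - θ) ^ 2 ∂Q' ∂P'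
      ≤ ∫ x, ((m : ℝ)⁻¹ * ∫ t, ((m : ℝ)⁻¹ * ∑ a, w (x a) t) ^ 2 ∂Q +
          ((m : ℝ)⁻¹ * ∑ a, g (x a) - θ) ^ 2) ∂P' := by
        refine integral_mono hWi.integral_prod_left
          ((hF2.integral_prod_left.const_mul _).add hgavg) fun x => ?_
        have := integral_sq_average_sub_le Q hm
          (φ := fun t => (m : ℝ)⁻¹ * ∑ a, w (x a) t) (hFm.comp measurable_prodMk_left)
          (hFB x) θ
        rwa [hcx x] at this
    _ = (m : ℝ)⁻¹ * ∫ x, ∫ t, ((m : ℝ)⁻¹ * ∑ a, w (x a) t) ^ 2 ∂Q ∂P' +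
          ∫ x, ((m : ℝ)⁻¹ * ∑ a, g (x a) - θ) ^ 2 ∂P' := by
        rw [integral_add (hF2.integral_prod_left.const_mul _) hgavg, integral_const_mul]
    _ ≤ (m : ℝ)⁻¹ * ((m : ℝ)⁻¹ * (∫ s, ∫ t, w s t ^ 2 ∂Q ∂P) +
          ∫ t, (∫ s, w s t ∂P) ^ 2 ∂Q) + (m : ℝ)⁻¹ * ∫ s, g s ^ 2 ∂P := by
        gcongr
        · have hswap := integral_integral_swap (f := fun s t => w s t ^ 2) hw2
          rw [integral_integral_swap hF2, hswap, ← integral_const_mul,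
            ← integral_add]
          · refine integral_mono hF2.integral_prod_right ?_ fun t => ?_
            · exact (hw2.integral_prod_right.const_mul _).add
                (integrable_of_abs_le (hg'.pow_const 2) fun t => sq_le (hg'B t))
            · simpa using integral_sq_average_sub_le P hm (hwr t) (fun s => hB s t) 0
          · exact hw2.integral_prod_right.const_mul _
          · exact integrable_of_abs_le (hg'.pow_const 2) fun t => sq_le (hg'B t)
        · have := integral_sq_average_sub_le P hm hg hgB θ
          have h0 : ∫ s, g s ∂P - θ = 0 := sub_self _
          rwa [h0, zero_pow two_ne_zero, add_zero] at this
    _ = _ := by ring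

/-! ### Independent subsamples of an i.i.d. sample -/

/-- Distinct coordinates of an i.i.d. sample form an i.i.d. sample. -/
lemma measurePreserving_precomp_embedding {ι κ Z : Type*} [Fintype ι] [Fintype κ]
    [MeasurableSpace Z] (ν : Measure Z) [IsProbabilityMeasure ν] (e : κ ↪ ι) :
    MeasurePreserving (fun (z : ι → Z) (k : κ) => z (e k)) (Measure.pi fun _ => ν)
      (Measure.pi fun _ => ν) := by
  refine ⟨by fun_prop, ?_⟩
  have h : ProbabilityTheory.iIndepFun (fun (i : ι) (z : ι → Z) => z i)
      (Measure.pi fun _ => ν) :=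
    ProbabilityTheory.iIndepFun_pi (X := fun _ z => z) fun _ => aemeasurable_id
  have h' := (ProbabilityTheory.iIndepFun_iff_map_fun_eq_pi_map
    (fun k => (measurable_pi_apply (e k)).aemeasurable)).1 (h.precomp e.injective)
  rw [h']
  congr
  ext1 k
  exact (measurePreserving_eval (fun _ : ι => ν) (e k)).map_eq

/-- Disjoint pairs of coordinates, split into two groups, form two independent i.i.d. samples. -/
lemma measurePreserving_pairs {ι Z : Type*} [Fintype ι] [MeasurableSpace Z] (ν : Measure Z)
    [IsProbabilityMeasure ν] {m : ℕ} (e : (Fin m ⊕ Fin m) ⊕ (Fin m ⊕ Fin m) ↪ ι) :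
    MeasurePreserving
      (fun z : ι → Z => ((fun a => (z (e (.inl (.inl a))), z (e (.inl (.inr a)))),
        fun b => (z (e (.inr (.inl b))), z (e (.inr (.inr b))))) :
        (Fin m → Z × Z) × (Fin m → Z × Z)))
      (Measure.pi fun _ => ν)
      ((Measure.pi fun _ => ν.prod ν).prod (Measure.pi fun _ => ν.prod ν)) := by
  have hpair : MeasurePreserving
      (fun z : Fin m ⊕ Fin m → Z => fun a => (z (.inl a), z (.inr a)))
      (Measure.pi fun _ => ν) (Measure.pi fun _ => ν.prod ν) :=
    (measurePreserving_arrowProdEquivProdArrow Z Z (Fin m) (fun _ => ν) fun _ => ν).symm.comp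
      (measurePreserving_sumPiEquivProdPi (X := fun _ : Fin m ⊕ Fin m => Z) fun _ => ν)
  exact (hpair.prod hpair).comp ((measurePreserving_sumPiEquivProdPi
    (X := fun _ : (Fin m ⊕ Fin m) ⊕ (Fin m ⊕ Fin m) => Z) fun _ => ν).comp
      (measurePreserving_precomp_embedding ν e))

/-! ### Elementary bounds for the Gaussian kernel and for `quadKernel` -/

lemma stdGaussian_nonneg {d : ℕ} (x : E d) : 0 ≤ stdGaussian x := by
  unfold stdGaussian; positivity

lemma stdGaussian_le_one {d : ℕ} (x : E d) : stdGaussian x ≤ 1 := by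
  unfold stdGaussian
  have h1 : (1 : ℝ) ≤ (2 * Real.pi) ^ ((d : ℝ) / 2) :=
    Real.one_le_rpow (by linarith [Real.pi_gt_three]) (by positivity)
  have h2 : Real.exp (-(1 / 2) * ∑ i, x i ^ 2) ≤ 1 := by
    rw [Real.exp_le_one_iff]
    have : 0 ≤ ∑ i, x i ^ 2 := Finset.sum_nonneg fun i _ => sq_nonneg _
    linarith
  have h3 : 1 / (2 * Real.pi) ^ ((d : ℝ) / 2) ≤ 1 := by
    rw [div_le_one (by positivity)]; exact h1
  exact mul_le_one₀ h3 (Real.exp_pos _).le h2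

lemma continuous_scaledGaussian {d : ℕ} (b : Fin d → ℝ) : Continuous (scaledGaussian b) := by
  unfold scaledGaussian stdGaussian
  fun_prop

lemma measurable_gaussKernel {d : ℕ} (b : Fin d → ℝ) :
    Measurable (Function.uncurry (gaussKernel b)) :=
  (continuous_scaledGaussian b).measurable.comp (measurable_fst.sub measurable_snd)

lemma gaussKernel_nonneg {d : ℕ} {b : Fin d → ℝ} (hb : ∀ i, 0 < b i) (x y : E d) :
    0 ≤ gaussKernel b x y :=
  mul_nonneg (div_nonneg zero_le_one (Finset.prod_nonneg fun i _ => (hb i).le))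
    (stdGaussian_nonneg _)

lemma gaussKernel_le {d : ℕ} {b : Fin d → ℝ} (hb : ∀ i, 0 < b i) (x y : E d) :
    gaussKernel b x y ≤ (∏ i, b i)⁻¹ := by
  rw [gaussKernel, scaledGaussian, one_div]
  exact mul_le_of_le_one_right (inv_nonneg.2 (Finset.prod_nonneg fun i _ => (hb i).le))
    (stdGaussian_le_one _)

section quadKernel

variable {X Y : Type*} {K : X → X → ℝ} {L : Y → Y → ℝ}

/-- By this symmetry the two projections in the two-sample bound coincide, whence the factor 2 in
front of the linear term of the variance. -/
lemma quadKernel_comm (hK : ∀ x y, K x y = K y x) (hL : ∀ x y, L x y = L y x)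
    (a b : (X × Y) × (X × Y)) : quadKernel K L a b = quadKernel K L b a := by
  simp only [quadKernel, hK b.1.1, hK b.2.1, hL b.1.2, hL b.2.2]
  ring

lemma abs_four_terms_le {s t u v B : ℝ} (hs : 0 ≤ s ∧ s ≤ B) (ht : 0 ≤ t ∧ t ≤ B)
    (hu : 0 ≤ u ∧ u ≤ B) (hv : 0 ≤ v ∧ v ≤ B) : |s - t - u + v| ≤ 2 * B := by
  rw [abs_le]
  constructor <;> linarith [hs.1, hs.2, ht.1, ht.2, hu.1, hu.2, hv.1, hv.2]

/-- In each bracket two signs are positive and two negative, so terms in [0, A] give 2A rather than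
4A. The bound serves integrability only: it is far too large for small bandwidths to enter the
variance. -/
lemma abs_quadKernel_le {A B : ℝ} (hK : ∀ x y, 0 ≤ K x y ∧ K x y ≤ A)
    (hL : ∀ x y, 0 ≤ L x y ∧ L x y ≤ B) (a b : (X × Y) × (X × Y)) :
    |quadKernel K L a b| ≤ A * B := by
  have h1 := abs_four_terms_le (hK a.1.1 b.1.1) (hK a.1.1 b.2.1) (hK a.2.1 b.1.1) (hK a.2.1 b.2.1)
  have h2 := abs_four_terms_le (hL a.1.2 b.1.2) (hL a.1.2 b.2.2) (hL a.2.2 b.1.2) (hL a.2.2 b.2.2)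
  have h3 := mul_le_mul h1 h2 (abs_nonneg _) ((abs_nonneg _).trans h1)
  rw [quadKernel, mul_assoc, abs_mul, abs_mul, abs_of_pos (by norm_num : (0 : ℝ) < 1 / 4)]
  linarith

lemma measurable_quadKernel [MeasurableSpace X] [MeasurableSpace Y]
    (hK : Measurable (Function.uncurry K)) (hL : Measurable (Function.uncurry L)) :
    Measurable (Function.uncurry (quadKernel K L)) := by
  have hK' : ∀ {u v : ((X × Y) × (X × Y)) × ((X × Y) × (X × Y)) → X}, Measurable u →
      Measurable v → Measurable fun c => K (u c) (v c) := fun hu hv => hK.comp (hu.prodMk hv)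
  have hL' : ∀ {u v : ((X × Y) × (X × Y)) × ((X × Y) × (X × Y)) → Y}, Measurable u →
      Measurable v → Measurable fun c => L (u c) (v c) := fun hu hv => hL.comp (hu.prodMk hv)
  unfold Function.uncurry quadKernel
  refine Measurable.mul (Measurable.const_mul (((Measurable.sub ?_ ?_).sub ?_).add ?_) _)
    (((Measurable.sub ?_ ?_).sub ?_).add ?_)
  all_goals first
    | exact hK' (by fun_prop) (by fun_prop)
    | exact hL' (by fun_prop) (by fun_prop)

end quadKernel

/-! ### Mean squared error of the HSIC statistic -/

section variance

variable {p q n m : ℕ} {lam : Fin p → ℝ} {mu : Fin q → ℝ}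

/-- The HSIC statistic is an average, over the permutations of the sample, of two-sample
U-statistics. -/
lemma hsicStat_eq_perm_average_two_sample (hm : 0 < m)
    (e : (Fin m ⊕ Fin m) ⊕ (Fin m ⊕ Fin m) ↪ Fin n) (z : Fin n → E p × E q) :
    hsicStat lam mu z = (n.factorial : ℝ)⁻¹ * ∑ σ : Equiv.Perm (Fin n),
      ((m : ℝ)⁻¹ * ∑ b, (m : ℝ)⁻¹ * ∑ a, quadKernel (gaussKernel lam) (gaussKernel mu)
        (z (σ (e (.inl (.inl a)))), z (σ (e (.inl (.inr a)))))
        (z (σ (e (.inr (.inl b)))), z (σ (e (.inr (.inr b)))))) := by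
  have hm' : (m : ℝ) ≠ 0 := by exact_mod_cast hm.ne'
  have h : ∀ a b : Fin m, (n.factorial : ℝ)⁻¹ * ∑ σ : Equiv.Perm (Fin n),
      quadKernel (gaussKernel lam) (gaussKernel mu)
        (z (σ (e (.inl (.inl a)))), z (σ (e (.inl (.inr a)))))
        (z (σ (e (.inr (.inl b)))), z (σ (e (.inr (.inr b))))) = hsicStat lam mu z := fun a b =>
    (hsicStat_eq_perm_average_quadKernel lam mu z _ _ _ _
      (e.injective.ne (by simp)) (e.injective.ne (by simp)) (e.injective.ne (by simp))
      (e.injective.ne (by simp)) (e.injective.ne (by simp)) (e.injective.ne (by simp))).symm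
  calc hsicStat lam mu z = (m : ℝ)⁻¹ * ∑ b : Fin m, (m : ℝ)⁻¹ * ∑ a : Fin m,
        (n.factorial : ℝ)⁻¹ * ∑ σ : Equiv.Perm (Fin n),
          quadKernel (gaussKernel lam) (gaussKernel mu)
            (z (σ (e (.inl (.inl a)))), z (σ (e (.inl (.inr a)))))
            (z (σ (e (.inr (.inl b)))), z (σ (e (.inr (.inr b))))) := by
        simp only [h]
        simp [hm']
    _ = _ := by
        simp only [Finset.mul_sum]
        conv_lhs =>
          enter [2, b]
          rw [Finset.sum_comm]
        rw [Finset.sum_comm]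
        refine Finset.sum_congr rfl fun σ _ => Finset.sum_congr rfl fun b _ =>
          Finset.sum_congr rfl fun a _ => ?_
        ring

/-- The mean squared error of the HSIC statistic. -/
lemma integral_sq_hsicStat_sub_le (ν : Measure (E p × E q)) [IsProbabilityMeasure ν]
    (hlam : ∀ i, 0 < lam i) (hmu : ∀ j, 0 < mu j) (hm : 0 < m) (hmn : 4 * m ≤ n) :
    ∫ z, (hsicStat lam mu z - ∫ a, ∫ b, quadKernel (gaussKernel lam) (gaussKernel mu) a b
        ∂(ν.prod ν) ∂(ν.prod ν)) ^ 2 ∂(Measure.pi fun _ : Fin n => ν) ≤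
      2 * (m : ℝ)⁻¹ * ∫ a, (∫ b, quadKernel (gaussKernel lam) (gaussKernel mu) a b
        ∂(ν.prod ν)) ^ 2 ∂(ν.prod ν) +
      (m : ℝ)⁻¹ ^ 2 * ∫ a, ∫ b, quadKernel (gaussKernel lam) (gaussKernel mu) a b ^ 2
        ∂(ν.prod ν) ∂(ν.prod ν) := by
  set w := quadKernel (gaussKernel lam) (gaussKernel mu) with hw_def
  set θ := ∫ a, ∫ b, w a b ∂(ν.prod ν) ∂(ν.prod ν) with hθ
  obtain ⟨e⟩ : Nonempty ((Fin m ⊕ Fin m) ⊕ (Fin m ⊕ Fin m) ↪ Fin n) :=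
    Function.Embedding.nonempty_of_card_le (by simp; omega)
  have hw : Measurable (Function.uncurry w) :=
    measurable_quadKernel (measurable_gaussKernel lam) (measurable_gaussKernel mu)
  have hB : ∀ a b, |w a b| ≤ (∏ i, lam i)⁻¹ * (∏ j, mu j)⁻¹ :=
    abs_quadKernel_le (fun x y => ⟨gaussKernel_nonneg hlam x y, gaussKernel_le hlam x y⟩)
      fun x y => ⟨gaussKernel_nonneg hmu x y, gaussKernel_le hmu x y⟩
  set B := (∏ i, lam i)⁻¹ * (∏ j, mu j)⁻¹
  have hcomm : ∀ a b, w a b = w b a :=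
    quadKernel_comm (gaussKernel_comm lam) (gaussKernel_comm mu)
  let Φ : (Fin m → (E p × E q) × (E p × E q)) × (Fin m → (E p × E q) × (E p × E q)) → ℝ :=
    fun u => ((m : ℝ)⁻¹ * ∑ b, (m : ℝ)⁻¹ * ∑ a, w (u.1 a) (u.2 b) - θ) ^ 2
  have hΦm : Measurable Φ := by
    refine Measurable.pow_const (Measurable.sub_const (Measurable.const_mul
      (Finset.measurable_fun_sum _ fun b _ => Measurable.const_mul
        (Finset.measurable_fun_sum _ fun a _ => ?_) _) _) _) 2
    exact hw.comp (g := Function.uncurry w)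
      (f := fun u : (Fin m → (E p × E q) × (E p × E q)) × (Fin m → (E p × E q) × (E p × E q)) =>
        (u.1 a, u.2 b)) (by fun_prop)
  have hΦB : ∀ u, |Φ u| ≤ (B + |θ|) ^ 2 := fun u => by
    simp only [Φ, abs_pow]
    gcongr
    exact (abs_sub _ _).trans (by
      gcongr; exact abs_average_le hm fun b => abs_average_le hm fun a => hB _ _)
  let τ : Equiv.Perm (Fin n) → (Fin m ⊕ Fin m) ⊕ (Fin m ⊕ Fin m) ↪ Fin n :=
    fun σ => e.trans σ.toEmbedding
  let π : Equiv.Perm (Fin n) → (Fin n → E p × E q) →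
      (Fin m → (E p × E q) × (E p × E q)) × (Fin m → (E p × E q) × (E p × E q)) := fun σ z =>
    (fun a => (z (τ σ (.inl (.inl a))), z (τ σ (.inl (.inr a)))),
      fun b => (z (τ σ (.inr (.inl b))), z (τ σ (.inr (.inr b)))))
  have hπ : ∀ σ, MeasurePreserving (π σ) (Measure.pi fun _ => ν)
      ((Measure.pi fun _ => ν.prod ν).prod (Measure.pi fun _ => ν.prod ν)) :=
    fun σ => measurePreserving_pairs ν (τ σ)
  have hint : ∀ σ, Integrable (fun z => Φ (π σ z)) (Measure.pi fun _ : Fin n => ν) := fun σ =>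
    integrable_of_abs_le (hΦm.comp (hπ σ).measurable) fun z => hΦB _
  have hn0 : (0 : ℝ) < n.factorial := by exact_mod_cast n.factorial_pos
  -- Convexity of the square: the squared average over permutations is at most the average of the
  -- squares. By `hπ` all the squares have the same integral, that of one two-sample U-statistic.
  have hconv : ∀ z : Fin n → E p × E q, (hsicStat lam mu z - θ) ^ 2 ≤
      (n.factorial : ℝ)⁻¹ * ∑ σ : Equiv.Perm (Fin n), Φ (π σ z) := by
    intro z
    set W : Equiv.Perm (Fin n) → ℝ := fun σ =>
      (m : ℝ)⁻¹ * ∑ b, (m : ℝ)⁻¹ * ∑ a, w ((π σ z).1 a) ((π σ z).2 b)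
    have hH : hsicStat lam mu z = (n.factorial : ℝ)⁻¹ * ∑ σ, W σ :=
      hsicStat_eq_perm_average_two_sample hm e z
    have hdev : hsicStat lam mu z - θ = (n.factorial : ℝ)⁻¹ * ∑ σ, (W σ - θ) := by
      rw [hH, Finset.sum_sub_distrib]
      simp only [Finset.sum_const, Finset.card_univ, Fintype.card_perm, Fintype.card_fin,
        nsmul_eq_mul]
      field_simp
    have hcs := sq_sum_le_card_mul_sum_sq (s := Finset.univ) (f := fun σ => W σ - θ)
    rw [Finset.card_univ, Fintype.card_perm, Fintype.card_fin] at hcs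
    rw [hdev, mul_pow]
    calc (n.factorial : ℝ)⁻¹ ^ 2 * (∑ σ, (W σ - θ)) ^ 2
        ≤ (n.factorial : ℝ)⁻¹ ^ 2 * (n.factorial * ∑ σ, (W σ - θ) ^ 2) := by gcongr
      _ = (n.factorial : ℝ)⁻¹ * ∑ σ, (W σ - θ) ^ 2 := by field_simp
  have hΦint : ∀ σ, ∫ z, Φ (π σ z) ∂(Measure.pi fun _ : Fin n => ν) =
      ∫ u, Φ u ∂((Measure.pi fun _ => ν.prod ν).prod (Measure.pi fun _ => ν.prod ν)) := fun σ => by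
    rw [← (hπ σ).map_eq, integral_map (hπ σ).measurable.aemeasurable hΦm.aestronglyMeasurable]
  have hmain := integral_sq_two_sample_le (ν.prod ν) (ν.prod ν) hm hw hB
  calc ∫ z, (hsicStat lam mu z - θ) ^ 2 ∂(Measure.pi fun _ : Fin n => ν)
      ≤ ∫ z, (n.factorial : ℝ)⁻¹ * ∑ σ : Equiv.Perm (Fin n), Φ (π σ z)
          ∂(Measure.pi fun _ : Fin n => ν) :=
        integral_mono_of_nonneg (Filter.Eventually.of_forall fun z => sq_nonneg _)
          ((integrable_finsetSum _ fun σ _ => hint σ).const_mul _)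
          (Filter.Eventually.of_forall hconv)
    _ = ∫ u, Φ u ∂((Measure.pi fun _ => ν.prod ν).prod (Measure.pi fun _ => ν.prod ν)) := by
        rw [integral_const_mul, integral_finsetSum _ fun σ _ => hint σ]
        simp only [hΦint, Finset.sum_const, Finset.card_univ, Fintype.card_perm, Fintype.card_fin,
          nsmul_eq_mul]
        field_simp
    _ ≤ _ := hmain
    _ = _ := by
        have : ∀ t, ∫ s, w s t ∂(ν.prod ν) = ∫ s, w t s ∂(ν.prod ν) := fun t => by
          simp only [hcomm _ t]
        simp only [this]
        ring

end variance

/-! ### Moments of `quadKernel` in terms of the covariance of the two kernels -/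

lemma _root_.MeasureTheory.Integrable.fun_sub {Z : Type*} [MeasurableSpace Z] {ν : Measure Z}
    {s t : Z → ℝ} (hs : Integrable s ν) (ht : Integrable t ν) :
    Integrable (fun z => s z - t z) ν := hs.sub ht

/-- The integral of a product of differences of an independent copy is twice a covariance. -/
lemma integral_prod_sub_mul_sub {Z : Type*} [MeasurableSpace Z] (ν : Measure Z)
    [IsProbabilityMeasure ν] {s t : Z → ℝ} (hs : Integrable s ν) (ht : Integrable t ν)
    (hst : Integrable (fun z => s z * t z) ν) :
    ∫ b, (s b.1 - s b.2) * (t b.1 - t b.2) ∂(ν.prod ν) =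
      2 * (∫ z, s z * t z ∂ν - (∫ z, s z ∂ν) * ∫ z, t z ∂ν) := by
  have h1 : Integrable (fun b : Z × Z => s b.1 * t b.1) (ν.prod ν) := hst.comp_fst ν
  have h2 : Integrable (fun b : Z × Z => s b.2 * t b.2) (ν.prod ν) := hst.comp_snd ν
  have h3 : Integrable (fun b : Z × Z => s b.1 * t b.2) (ν.prod ν) := hs.mul_prod ht
  have h4 : Integrable (fun b : Z × Z => t b.1 * s b.2) (ν.prod ν) := ht.mul_prod hs
  have e1 : ∫ b : Z × Z, s b.1 * t b.1 ∂(ν.prod ν) = ∫ z, s z * t z ∂ν := by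
    simpa using integral_fun_fst (μ := ν) (ν := ν) fun z => s z * t z
  have e2 : ∫ b : Z × Z, s b.2 * t b.2 ∂(ν.prod ν) = ∫ z, s z * t z ∂ν := by
    simpa using integral_fun_snd (μ := ν) (ν := ν) fun z => s z * t z
  have expand : (fun b : Z × Z => (s b.1 - s b.2) * (t b.1 - t b.2)) = fun b =>
      (s b.1 * t b.1 + s b.2 * t b.2) - (s b.1 * t b.2 + t b.1 * s b.2) := by
    ext b; ring
  rw [expand, integral_sub (h1.fun_add h2) (h3.fun_add h4), integral_add h1 h2, integral_add h3 h4,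
    e1, e2, integral_prod_mul, integral_prod_mul]
  ring

/-- The same identity for sums, as an upper bound. -/
lemma integral_prod_add_mul_add {Z : Type*} [MeasurableSpace Z] (ν : Measure Z)
    [IsProbabilityMeasure ν] {s t : Z → ℝ} (hs : Integrable s ν) (ht : Integrable t ν)
    (hst : Integrable (fun z => s z * t z) ν) :
    ∫ b, (s b.1 + s b.2) * (t b.1 + t b.2) ∂(ν.prod ν) =
      2 * (∫ z, s z * t z ∂ν + (∫ z, s z ∂ν) * ∫ z, t z ∂ν) := by
  have h1 : Integrable (fun b : Z × Z => s b.1 * t b.1) (ν.prod ν) := hst.comp_fst ν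
  have h2 : Integrable (fun b : Z × Z => s b.2 * t b.2) (ν.prod ν) := hst.comp_snd ν
  have h3 : Integrable (fun b : Z × Z => s b.1 * t b.2) (ν.prod ν) := hs.mul_prod ht
  have h4 : Integrable (fun b : Z × Z => t b.1 * s b.2) (ν.prod ν) := ht.mul_prod hs
  have e1 : ∫ b : Z × Z, s b.1 * t b.1 ∂(ν.prod ν) = ∫ z, s z * t z ∂ν := by
    simpa using integral_fun_fst (μ := ν) (ν := ν) fun z => s z * t z
  have e2 : ∫ b : Z × Z, s b.2 * t b.2 ∂(ν.prod ν) = ∫ z, s z * t z ∂ν := by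
    simpa using integral_fun_snd (μ := ν) (ν := ν) fun z => s z * t z
  have expand : (fun b : Z × Z => (s b.1 + s b.2) * (t b.1 + t b.2)) = fun b =>
      (s b.1 * t b.1 + s b.2 * t b.2) + (s b.1 * t b.2 + t b.1 * s b.2) := by
    ext b; ring
  rw [expand, integral_add (h1.fun_add h2) (h3.fun_add h4), integral_add h1 h2, integral_add h3 h4,
    e1, e2, integral_prod_mul, integral_prod_mul]
  ring

/-- The covariance of `K x (X)` and `L y (Y)` for `(X, Y)` of law `ν`. -/
noncomputable def kernelCov {X Y : Type*} [MeasurableSpace X] [MeasurableSpace Y]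
    (K : X → X → ℝ) (L : Y → Y → ℝ) (ν : Measure (X × Y)) (z : X × Y) : ℝ :=
  ∫ u, K z.1 u.1 * L z.2 u.2 ∂ν - (∫ u, K z.1 u.1 ∂ν) * ∫ u, L z.2 u.2 ∂ν

section kernelCov

variable {X Y : Type*} [MeasurableSpace X] [MeasurableSpace Y] {K : X → X → ℝ} {L : Y → Y → ℝ}
  {A B : ℝ}

lemma measurable_kernelCov (hK : Measurable (Function.uncurry K))
    (hL : Measurable (Function.uncurry L)) (ν : Measure (X × Y)) [SFinite ν] :
    Measurable (kernelCov K L ν) := by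
  have hK' : Measurable fun c : (X × Y) × (X × Y) => K c.1.1 c.2.1 :=
    hK.comp (g := Function.uncurry K) (f := fun c : (X × Y) × (X × Y) => (c.1.1, c.2.1))
      (by fun_prop)
  have hL' : Measurable fun c : (X × Y) × (X × Y) => L c.1.2 c.2.2 :=
    hL.comp (g := Function.uncurry L) (f := fun c : (X × Y) × (X × Y) => (c.1.2, c.2.2))
      (by fun_prop)
  exact ((hK'.mul hL').stronglyMeasurable.integral_prod_right'.measurable).sub
    (hK'.stronglyMeasurable.integral_prod_right'.measurable.mul
      hL'.stronglyMeasurable.integral_prod_right'.measurable)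

variable (ν : Measure (X × Y)) [IsProbabilityMeasure ν]

lemma abs_kernelCov_le (hKA : ∀ x y, 0 ≤ K x y ∧ K x y ≤ A) (hLB : ∀ x y, 0 ≤ L x y ∧ L x y ≤ B)
    (z : X × Y) : |kernelCov K L ν z| ≤ 2 * (A * B) := by
  have hK : ∀ x y, |K x y| ≤ A := fun x y => by rw [abs_of_nonneg (hKA x y).1]; exact (hKA x y).2
  have hL : ∀ x y, |L x y| ≤ B := fun x y => by rw [abs_of_nonneg (hLB x y).1]; exact (hLB x y).2
  have hA : 0 ≤ A := (hKA z.1 z.1).1.trans (hKA z.1 z.1).2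
  have h1 : |∫ u, K z.1 u.1 * L z.2 u.2 ∂ν| ≤ A * B := abs_integral_le fun u => by
    rw [abs_mul]; exact mul_le_mul (hK _ _) (hL _ _) (abs_nonneg _) hA
  have h2 : |∫ u, K z.1 u.1 ∂ν| ≤ A := abs_integral_le fun u => hK _ _
  have h3 : |∫ u, L z.2 u.2 ∂ν| ≤ B := abs_integral_le fun u => hL _ _
  calc |kernelCov K L ν z| ≤ |∫ u, K z.1 u.1 * L z.2 u.2 ∂ν| +
        |(∫ u, K z.1 u.1 ∂ν) * ∫ u, L z.2 u.2 ∂ν| := abs_sub _ _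
    _ ≤ A * B + A * B := by
        rw [abs_mul]
        gcongr
    _ = _ := by ring

/-- For fixed `a` the kernel is ¼ (s(b₁) − s(b₂)) (t(b₁) − t(b₂)), where s and t are the differences
of K and of L at the two points of `a`. Its mean is therefore half the covariance of s and t, and
bilinearity splits this into four values of `kernelCov`. -/
lemma integral_quadKernel (hK : Measurable (Function.uncurry K))
    (hL : Measurable (Function.uncurry L)) (hKA : ∀ x y, 0 ≤ K x y ∧ K x y ≤ A)
    (hLB : ∀ x y, 0 ≤ L x y ∧ L x y ≤ B) (a : (X × Y) × (X × Y)) :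
    ∫ b, quadKernel K L a b ∂(ν.prod ν) =
      1 / 2 * (kernelCov K L ν a.1 - kernelCov K L ν (a.1.1, a.2.2) -
        kernelCov K L ν (a.2.1, a.1.2) + kernelCov K L ν a.2) := by
  have hKm : ∀ x, Measurable fun u : X × Y => K x u.1 := fun x =>
    (hK.comp measurable_prodMk_left).comp measurable_fst
  have hLm : ∀ y, Measurable fun u : X × Y => L y u.2 := fun y =>
    (hL.comp measurable_prodMk_left).comp measurable_snd
  have hKb : ∀ x y, |K x y| ≤ A := fun x y => by rw [abs_of_nonneg (hKA x y).1]; exact (hKA x y).2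
  have hLb : ∀ x y, |L x y| ≤ B := fun x y => by rw [abs_of_nonneg (hLB x y).1]; exact (hLB x y).2
  have iK : ∀ x, Integrable (fun u : X × Y => K x u.1) ν := fun x =>
    integrable_of_abs_le (hKm x) fun u => hKb x u.1
  have iL : ∀ y, Integrable (fun u : X × Y => L y u.2) ν := fun y =>
    integrable_of_abs_le (hLm y) fun u => hLb y u.2
  have iKL : ∀ x y, Integrable (fun u : X × Y => K x u.1 * L y u.2) ν := fun x y =>
    integrable_of_abs_le (B := A * B) ((hKm x).mul (hLm y)) fun u => by
      rw [abs_mul]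
      exact mul_le_mul (hKb _ _) (hLb _ _) (abs_nonneg _)
        ((hKA x u.1).1.trans (hKA x u.1).2)
  set s : X × Y → ℝ := fun u => K a.1.1 u.1 - K a.2.1 u.1
  set t : X × Y → ℝ := fun u => L a.1.2 u.2 - L a.2.2 u.2
  have expand : (fun u => s u * t u) = fun u : X × Y =>
      (K a.1.1 u.1 * L a.1.2 u.2 + K a.2.1 u.1 * L a.2.2 u.2) -
      (K a.1.1 u.1 * L a.2.2 u.2 + K a.2.1 u.1 * L a.1.2 u.2) := by
    ext u; simp only [s, t]; ring
  have ist : Integrable (fun u => s u * t u) ν := by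
    rw [expand]
    exact ((iKL _ _).fun_add (iKL _ _)).fun_sub ((iKL _ _).fun_add (iKL _ _))
  have hquad : ∀ b : (X × Y) × (X × Y),
      quadKernel K L a b = 1 / 4 * ((s b.1 - s b.2) * (t b.1 - t b.2)) := fun b => by
    simp only [quadKernel, s, t]; ring
  have is : Integrable s ν := (iK _).fun_sub (iK _)
  have it : Integrable t ν := (iL _).fun_sub (iL _)
  simp only [hquad]
  rw [integral_const_mul, integral_prod_sub_mul_sub ν is it ist, expand,
    integral_sub ((iKL _ _).fun_add (iKL _ _)) ((iKL _ _).fun_add (iKL _ _)),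
    integral_add (iKL _ _) (iKL _ _), integral_add (iKL _ _) (iKL _ _),
    integral_sub (iK _) (iK _), integral_sub (iL _) (iL _)]
  simp only [kernelCov]
  ring

/-- The expectation of the HSIC kernel. -/
lemma integral_integral_quadKernel (hK : Measurable (Function.uncurry K))
    (hL : Measurable (Function.uncurry L)) (hKA : ∀ x y, 0 ≤ K x y ∧ K x y ≤ A)
    (hLB : ∀ x y, 0 ≤ L x y ∧ L x y ≤ B) :
    ∫ a, ∫ b, quadKernel K L a b ∂(ν.prod ν) ∂(ν.prod ν) =
      ∫ z, kernelCov K L ν z ∂ν - ∫ a, kernelCov K L ν (a.1.1, a.2.2) ∂(ν.prod ν) := by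
  simp only [integral_quadKernel ν hK hL hKA hLB]
  set G := kernelCov K L ν with hGdef
  have hG : Measurable G := measurable_kernelCov hK hL ν
  have hGb : ∀ z, |G z| ≤ 2 * (A * B) := abs_kernelCov_le ν hKA hLB
  have i0 : Integrable G ν := integrable_of_abs_le hG hGb
  have i1 : Integrable (fun a : (X × Y) × (X × Y) => G a.1) (ν.prod ν) := i0.comp_fst ν
  have i2 : Integrable (fun a : (X × Y) × (X × Y) => G a.2) (ν.prod ν) := i0.comp_snd ν
  have i3 : Integrable (fun a : (X × Y) × (X × Y) => G (a.1.1, a.2.2)) (ν.prod ν) :=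
    integrable_of_abs_le (by fun_prop) fun a => hGb _
  have i4 : Integrable (fun a : (X × Y) × (X × Y) => G (a.2.1, a.1.2)) (ν.prod ν) :=
    integrable_of_abs_le (by fun_prop) fun a => hGb _
  have e1 : ∫ a : (X × Y) × (X × Y), G a.1 ∂(ν.prod ν) = ∫ z, G z ∂ν := by
    simpa using integral_fun_fst (μ := ν) (ν := ν) G
  have e2 : ∫ a : (X × Y) × (X × Y), G a.2 ∂(ν.prod ν) = ∫ z, G z ∂ν := by
    simpa using integral_fun_snd (μ := ν) (ν := ν) G
  have e4 : ∫ a : (X × Y) × (X × Y), G (a.2.1, a.1.2) ∂(ν.prod ν) =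
      ∫ a : (X × Y) × (X × Y), G (a.1.1, a.2.2) ∂(ν.prod ν) :=
    integral_prod_swap (μ := ν) (ν := ν) fun a : (X × Y) × (X × Y) => G (a.1.1, a.2.2)
  rw [integral_const_mul, integral_add ((i1.fun_sub i3).fun_sub i4) i2,
    integral_sub (i1.fun_sub i3) i4,
    integral_sub i1 i3, e1, e2, e4]
  ring

/-- The second moment of the first projection of the HSIC kernel. -/
lemma integral_sq_integral_quadKernel_le (hK : Measurable (Function.uncurry K))
    (hL : Measurable (Function.uncurry L)) (hKA : ∀ x y, 0 ≤ K x y ∧ K x y ≤ A)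
    (hLB : ∀ x y, 0 ≤ L x y ∧ L x y ≤ B) :
    ∫ a, (∫ b, quadKernel K L a b ∂(ν.prod ν)) ^ 2 ∂(ν.prod ν) ≤
      2 * (∫ z, kernelCov K L ν z ^ 2 ∂ν +
        ∫ a, kernelCov K L ν (a.1.1, a.2.2) ^ 2 ∂(ν.prod ν)) := by
  simp only [integral_quadKernel ν hK hL hKA hLB]
  set G := kernelCov K L ν with hGdef
  have hG : Measurable G := measurable_kernelCov hK hL ν
  have hGb : ∀ z, |G z ^ 2| ≤ (2 * (A * B)) ^ 2 := fun z => by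
    rw [abs_pow]
    gcongr
    exact abs_kernelCov_le ν hKA hLB z
  have i0 : Integrable (fun z => G z ^ 2) ν := integrable_of_abs_le (by fun_prop) hGb
  have i1 : Integrable (fun a : (X × Y) × (X × Y) => G a.1 ^ 2) (ν.prod ν) := i0.comp_fst ν
  have i2 : Integrable (fun a : (X × Y) × (X × Y) => G a.2 ^ 2) (ν.prod ν) := i0.comp_snd ν
  have i3 : Integrable (fun a : (X × Y) × (X × Y) => G (a.1.1, a.2.2) ^ 2) (ν.prod ν) :=
    integrable_of_abs_le (by fun_prop) fun a => hGb _
  have i4 : Integrable (fun a : (X × Y) × (X × Y) => G (a.2.1, a.1.2) ^ 2) (ν.prod ν) :=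
    integrable_of_abs_le (by fun_prop) fun a => hGb _
  have e1 : ∫ a : (X × Y) × (X × Y), G a.1 ^ 2 ∂(ν.prod ν) = ∫ z, G z ^ 2 ∂ν := by
    simpa using integral_fun_fst (μ := ν) (ν := ν) fun z => G z ^ 2
  have e2 : ∫ a : (X × Y) × (X × Y), G a.2 ^ 2 ∂(ν.prod ν) = ∫ z, G z ^ 2 ∂ν := by
    simpa using integral_fun_snd (μ := ν) (ν := ν) fun z => G z ^ 2
  have e4 : ∫ a : (X × Y) × (X × Y), G (a.2.1, a.1.2) ^ 2 ∂(ν.prod ν) =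
      ∫ a : (X × Y) × (X × Y), G (a.1.1, a.2.2) ^ 2 ∂(ν.prod ν) :=
    integral_prod_swap (μ := ν) (ν := ν) fun a : (X × Y) × (X × Y) => G (a.1.1, a.2.2) ^ 2
  calc ∫ a : (X × Y) × (X × Y), (1 / 2 * (G a.1 - G (a.1.1, a.2.2) - G (a.2.1, a.1.2) + G a.2)) ^ 2
        ∂(ν.prod ν)
      ≤ ∫ a : (X × Y) × (X × Y), (G a.1 ^ 2 + G (a.1.1, a.2.2) ^ 2 + G (a.2.1, a.1.2) ^ 2 +
          G a.2 ^ 2) ∂(ν.prod ν) := by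
        refine integral_mono_of_nonneg (Filter.Eventually.of_forall fun a => sq_nonneg _)
          (((i1.fun_add i3).fun_add i4).fun_add i2) (Filter.Eventually.of_forall fun a => ?_)
        simp only
        generalize G a.1 = r, G (a.1.1, a.2.2) = s, G (a.2.1, a.1.2) = t, G a.2 = u
        -- Cauchy–Schwarz for four signed terms: the factor 4 it costs is cancelled by (1/2)². The
        -- hints are the squares of the pairwise differences of the signed terms.
        nlinarith [sq_nonneg (r + s), sq_nonneg (r + t), sq_nonneg (r - u), sq_nonneg (s - t),
          sq_nonneg (s + u), sq_nonneg (t + u)]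
    _ = _ := by
        rw [integral_add ((i1.fun_add i3).fun_add i4) i2, integral_add (i1.fun_add i3) i4,
          integral_add i1 i3, e1, e2, e4]
        ring

/-- The conditional second moment of the HSIC kernel, given one pair of observations. -/
lemma integral_sq_quadKernel_le (hK : Measurable (Function.uncurry K))
    (hL : Measurable (Function.uncurry L)) (hKA : ∀ x y, 0 ≤ K x y ∧ K x y ≤ A)
    (hLB : ∀ x y, 0 ≤ L x y ∧ L x y ≤ B) {k l c : ℝ} (hk : ∀ x, ∫ u, K x u.1 ^ 2 ∂ν ≤ k)
    (hl : ∀ y, ∫ u, L y u.2 ^ 2 ∂ν ≤ l) (hc : ∀ x y, ∫ u, K x u.1 ^ 2 * L y u.2 ^ 2 ∂ν ≤ c)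
    (a : (X × Y) × (X × Y)) :
    ∫ b, quadKernel K L a b ^ 2 ∂(ν.prod ν) ≤ 8 * (c + k * l) := by
  have hKm : ∀ x, Measurable fun u : X × Y => K x u.1 := fun x =>
    (hK.comp measurable_prodMk_left).comp measurable_fst
  have hLm : ∀ y, Measurable fun u : X × Y => L y u.2 := fun y =>
    (hL.comp measurable_prodMk_left).comp measurable_snd
  have hKb : ∀ x y, |K x y ^ 2| ≤ A ^ 2 := fun x y => by
    rw [abs_pow, abs_of_nonneg (hKA x y).1]
    exact pow_le_pow_left₀ (hKA x y).1 (hKA x y).2 2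
  have hLb : ∀ x y, |L x y ^ 2| ≤ B ^ 2 := fun x y => by
    rw [abs_pow, abs_of_nonneg (hLB x y).1]
    exact pow_le_pow_left₀ (hLB x y).1 (hLB x y).2 2
  have iK : ∀ x, Integrable (fun u : X × Y => K x u.1 ^ 2) ν := fun x =>
    integrable_of_abs_le ((hKm x).pow_const 2) fun u => hKb x u.1
  have iL : ∀ y, Integrable (fun u : X × Y => L y u.2 ^ 2) ν := fun y =>
    integrable_of_abs_le ((hLm y).pow_const 2) fun u => hLb y u.2
  have iKL : ∀ x y, Integrable (fun u : X × Y => K x u.1 ^ 2 * L y u.2 ^ 2) ν := fun x y =>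
    integrable_of_abs_le (B := A ^ 2 * B ^ 2) (((hKm x).pow_const 2).mul ((hLm y).pow_const 2))
      fun u => by
        rw [abs_mul]
        exact mul_le_mul (hKb _ _) (hLb _ _) (abs_nonneg _) (sq_nonneg _)
  set s : X × Y → ℝ := fun u => K a.1.1 u.1 ^ 2 + K a.2.1 u.1 ^ 2
  set t : X × Y → ℝ := fun u => L a.1.2 u.2 ^ 2 + L a.2.2 u.2 ^ 2
  have expand : (fun u => s u * t u) = fun u : X × Y =>
      (K a.1.1 u.1 ^ 2 * L a.1.2 u.2 ^ 2 + K a.2.1 u.1 ^ 2 * L a.2.2 u.2 ^ 2) +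
      (K a.1.1 u.1 ^ 2 * L a.2.2 u.2 ^ 2 + K a.2.1 u.1 ^ 2 * L a.1.2 u.2 ^ 2) := by
    ext u; simp only [s, t]; ring
  have is : Integrable s ν := (iK _).fun_add (iK _)
  have it : Integrable t ν := (iL _).fun_add (iL _)
  have ist : Integrable (fun u => s u * t u) ν := by
    rw [expand]
    exact ((iKL _ _).fun_add (iKL _ _)).fun_add ((iKL _ _).fun_add (iKL _ _))
  have iall : Integrable (fun b : (X × Y) × (X × Y) => (s b.1 + s b.2) * (t b.1 + t b.2))
      (ν.prod ν) := by
    have : (fun b : (X × Y) × (X × Y) => (s b.1 + s b.2) * (t b.1 + t b.2)) = fun b =>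
        (s b.1 * t b.1 + s b.2 * t b.2) + (s b.1 * t b.2 + t b.1 * s b.2) := by
      ext b; ring
    rw [this]
    exact ((ist.comp_fst ν).fun_add (ist.comp_snd ν)).fun_add
      ((is.mul_prod it).fun_add (it.mul_prod is))
  -- Applied to both brackets of `quadKernel`, this costs 4 · 4, which the square of the prefactor
  -- 1/4 cancels.
  have four_sq : ∀ r s t u : ℝ, (r - s - t + u) ^ 2 ≤ 4 * ((r ^ 2 + t ^ 2) + (s ^ 2 + u ^ 2)) :=
    fun r s t u => by
      nlinarith [sq_nonneg (r + s), sq_nonneg (r + t), sq_nonneg (r - u), sq_nonneg (s - t),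
        sq_nonneg (s + u), sq_nonneg (t + u)]
  calc ∫ b, quadKernel K L a b ^ 2 ∂(ν.prod ν)
      ≤ ∫ b : (X × Y) × (X × Y), (s b.1 + s b.2) * (t b.1 + t b.2) ∂(ν.prod ν) := by
        refine integral_mono_of_nonneg (Filter.Eventually.of_forall fun b => sq_nonneg _) iall
          (Filter.Eventually.of_forall fun b => ?_)
        have h1 := four_sq (K a.1.1 b.1.1) (K a.1.1 b.2.1) (K a.2.1 b.1.1) (K a.2.1 b.2.1)
        have h2 := four_sq (L a.1.2 b.1.2) (L a.1.2 b.2.2) (L a.2.2 b.1.2) (L a.2.2 b.2.2)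
        have h3 := mul_le_mul h1 h2 (sq_nonneg _) ((sq_nonneg _).trans h1)
        simp only [quadKernel, mul_pow, s, t]
        linarith
    -- The terms with one observation in both factors are joint second moments, bounded through `c`.
    -- In the cross terms the two observations are independent, so these factor and are bounded
    -- through `k * l`.
    _ = 2 * (∫ z, s z * t z ∂ν + (∫ z, s z ∂ν) * ∫ z, t z ∂ν) :=
        integral_prod_add_mul_add ν is it ist
    _ ≤ 2 * (4 * c + (2 * k) * (2 * l)) := by
        have e1 : ∫ z, s z * t z ∂ν ≤ 4 * c := by
          rw [expand, integral_add ((iKL _ _).fun_add (iKL _ _)) ((iKL _ _).fun_add (iKL _ _)),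
            integral_add (iKL _ _) (iKL _ _), integral_add (iKL _ _) (iKL _ _)]
          linarith [hc a.1.1 a.1.2, hc a.2.1 a.2.2, hc a.1.1 a.2.2, hc a.2.1 a.1.2]
        have e2 : ∫ z, s z ∂ν ≤ 2 * k := by
          rw [integral_add (iK _) (iK _)]
          linarith [hk a.1.1, hk a.2.1]
        have e3 : ∫ z, t z ∂ν ≤ 2 * l := by
          rw [integral_add (iL _) (iL _)]
          linarith [hl a.1.2, hl a.2.2]
        have e4 : 0 ≤ ∫ z, t z ∂ν := integral_nonneg fun z => by positivity
        have e5 : 0 ≤ 2 * k := (integral_nonneg fun z => by positivity).trans e2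
        gcongr
    _ = _ := by ring

end kernelCov

/-! ### Plancherel's theorem and Gaussian convolutions -/

lemma eLpNorm_two_eq_sqrt {α F : Type*} [MeasurableSpace α] {μ : Measure α}
    [NormedAddCommGroup F] {f : α → F} (hf : MemLp f 2 μ) :
    eLpNorm f 2 μ = ENNReal.ofReal (Real.sqrt (∫ x, ‖f x‖ ^ 2 ∂μ)) := by
  rw [hf.eLpNorm_eq_integral_rpow_norm two_ne_zero ENNReal.ofNat_ne_top, Real.sqrt_eq_rpow]
  simp

section Fourier

open scoped FourierTransform SchwartzMap ContDiff

variable {V : Type*} [NormedAddCommGroup V] [InnerProductSpace ℝ V] [MeasurableSpace V]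
  [BorelSpace V] [FiniteDimensional ℝ V]

/-- Self-adjointness of the Fourier transform on `L¹`. -/
lemma integral_fourier_mul_eq {f g : V → ℂ} (hf : Integrable f) (hg : Integrable g) :
    ∫ ξ, 𝓕 f ξ * g ξ = ∫ x, f x * 𝓕 g x := by
  have h := VectorFourier.integral_fourierIntegral_smul_eq_flip (L := innerₗ V)
    (μ := volume) (ν := volume) Real.continuous_fourierChar continuous_inner hf hg
  rw [flip_innerₗ] at h
  exact h

lemma continuous_fourier {f : V → ℂ} (hf : Integrable f) : Continuous (𝓕 f) :=
  VectorFourier.fourierIntegral_continuous Real.continuous_fourierChar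
    (by exact continuous_inner) hf

/-- On `L¹ ∩ L²` the Fourier transform on `L²` is given by the Fourier integral. -/
lemma coeFn_fourier_toLp_ae_eq {f : V → ℂ} (hf : Integrable f) (hf2 : MemLp f 2 volume) :
    ((𝓕 (hf2.toLp f) : Lp ℂ 2 (volume : Measure V)) : V → ℂ) =ᵐ[volume] 𝓕 f := by
  -- Both sides are tested against smooth compactly supported functions. These are Schwartz
  -- functions, for which the transform on L² agrees with the transform of tempered distributions;
  -- self-adjointness on L¹ then moves the transform back to f.
  refine ae_eq_of_integral_contDiff_smul_eq ((Lp.memLp _).locallyIntegrable one_le_two)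
    (continuous_fourier hf).locallyIntegrable fun g g_smooth g_cpt => ?_
  have hg₁ : HasCompactSupport (Complex.ofRealCLM ∘ g) := g_cpt.comp_left rfl
  have hg₂ : ContDiff ℝ ∞ (Complex.ofRealCLM ∘ g) := by fun_prop
  set φ : 𝓢(V, ℂ) := hg₁.toSchwartzMap hg₂
  have hφ : ∀ x, φ x = g x := fun x => by simp [φ]
  have h1 := DFunLike.congr_fun (Lp.fourier_toTemperedDistribution_eq (hf2.toLp f)) φ
  rw [TemperedDistribution.fourier_apply, Lp.toTemperedDistribution_apply,
    Lp.toTemperedDistribution_apply] at h1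
  calc ∫ x, g x • (𝓕 (hf2.toLp f) : Lp ℂ 2 (volume : Measure V)) x
      = ∫ x, φ x • (𝓕 (hf2.toLp f) : Lp ℂ 2 (volume : Measure V)) x := by simp [hφ]
    _ = ∫ x, (𝓕 φ) x • (hf2.toLp f) x := h1.symm
    _ = ∫ x, 𝓕 (φ : V → ℂ) x * f x := by
        refine integral_congr_ae ?_
        filter_upwards [hf2.coeFn_toLp] with x hx
        rw [hx, SchwartzMap.fourier_coe]
        rfl
    _ = ∫ x, φ x * 𝓕 f x := integral_fourier_mul_eq φ.integrable hf
    _ = _ := by simp [hφ]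

/-- Plancherel's theorem on `L¹ ∩ L²`. -/
lemma memLp_fourier {f : V → ℂ} (hf : Integrable f) (hf2 : MemLp f 2 volume) :
    MemLp (𝓕 f) 2 volume :=
  (memLp_congr_ae (coeFn_fourier_toLp_ae_eq hf hf2)).1 (Lp.memLp _)

lemma integral_sq_norm_fourier {f : V → ℂ} (hf : Integrable f) (hf2 : MemLp f 2 volume) :
    ∫ w, ‖𝓕 f w‖ ^ 2 = ∫ x, ‖f x‖ ^ 2 := by
  have h := Lp.norm_fourier_eq (hf2.toLp f)
  rw [Lp.norm_def, Lp.norm_def, eLpNorm_congr_ae (coeFn_fourier_toLp_ae_eq hf hf2),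
    eLpNorm_congr_ae hf2.coeFn_toLp, eLpNorm_two_eq_sqrt (memLp_fourier hf hf2),
    eLpNorm_two_eq_sqrt hf2, ENNReal.toReal_ofReal (Real.sqrt_nonneg _),
    ENNReal.toReal_ofReal (Real.sqrt_nonneg _)] at h
  rwa [Real.sqrt_inj (integral_nonneg fun _ => by positivity)
    (integral_nonneg fun _ => by positivity)] at h

/-- The isotropic Gaussian density with standard deviation `h`. -/
noncomputable def isoGaussian (h : ℝ) (t : V) : ℝ :=
  (1 / (2 * Real.pi * h ^ 2)) ^ ((Module.finrank ℝ V : ℝ) / 2) *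
    Real.exp (-‖t‖ ^ 2 / (2 * h ^ 2))

/-- The Fourier transform of `ψ`, damped by that of the Gaussian density. -/
noncomputable def dampedFourier (h : ℝ) (ψ : V → ℝ) (w : V) : ℂ :=
  Real.exp (-(2 * Real.pi ^ 2 * h ^ 2) * ‖w‖ ^ 2) * 𝓕 (fun x => (ψ x : ℂ)) w

variable {h : ℝ} {ψ : V → ℝ}

/-- The convolution with a Gaussian density, by Fourier inversion. -/
lemma integral_isoGaussian_eq_fourierInv (hh : 0 < h) (hψ : Integrable ψ) (z : V) :
    ((∫ t, isoGaussian h (z - t) * ψ t : ℝ) : ℂ) = 𝓕⁻ (dampedFourier h ψ) z := by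
  set b : ℂ := ((2 * Real.pi ^ 2 * h ^ 2 : ℝ) : ℂ) with hb
  have hb0 : 0 < b.re := by rw [hb, Complex.ofReal_re]; positivity
  have hgi := GaussianFourier.integrable_cexp_neg_mul_sq_norm_add hb0 (2 * Real.pi * Complex.I) z
  have hpi : (Real.pi : ℂ) ≠ 0 := by exact_mod_cast Real.pi_ne_zero
  have hhc : (h : ℂ) ≠ 0 := by exact_mod_cast hh.ne'
  -- The Gaussian density centred at z is itself a Fourier transform, of a Gaussian with a phase.
  -- Self-adjointness then moves the transform onto ψ, so that no general inversion theorem is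
  -- needed.
  have hF : ∀ t : V, 𝓕 (fun v : V => Complex.exp (-b * ‖v‖ ^ 2 + 2 * Real.pi * Complex.I *
      (inner ℝ z v : ℝ))) t = (isoGaussian h (z - t) : ℝ) := fun t => by
    rw [fourier_gaussian_innerProductSpace' hb0, isoGaussian]
    push_cast
    congr 1
    · rw [Complex.ofReal_cpow (by positivity)]
      push_cast
      congr 1
      rw [hb]
      push_cast
      field_simp
    · congr 1
      rw [hb]
      push_cast
      field_simp
  have key := integral_fourier_mul_eq hgi hψ.ofReal
  simp only [hF] at key
  rw [Real.fourierInv_eq', ← integral_complex_ofReal]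
  push_cast
  refine key.trans (integral_congr_ae (Filter.Eventually.of_forall fun w => ?_))
  simp only [dampedFourier, smul_eq_mul]
  rw [← mul_assoc, Complex.ofReal_exp, ← Complex.exp_add, real_inner_comm w z]
  congr 2
  rw [hb]
  push_cast
  ring

lemma norm_dampedFourier_le (h : ℝ) (ψ : V → ℝ) (w : V) :
    ‖dampedFourier h ψ w‖ ≤ ‖𝓕 (fun x => (ψ x : ℂ)) w‖ := by
  rw [dampedFourier, norm_mul, Complex.norm_real, Real.norm_eq_abs, abs_of_pos (Real.exp_pos _)]
  refine mul_le_of_le_one_left (norm_nonneg _) (Real.exp_le_one_iff.2 ?_)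
  have : 0 ≤ 2 * Real.pi ^ 2 * h ^ 2 * ‖w‖ ^ 2 := by positivity
  linarith

lemma continuous_dampedFourier (hψ : Integrable ψ) : Continuous (dampedFourier h ψ) := by
  have := continuous_fourier (hψ.ofReal (𝕜 := ℂ))
  unfold dampedFourier
  fun_prop

/-- The transform of ψ is bounded but need not be integrable; the Gaussian factor makes the product
integrable, so that self-adjointness on L¹ applies to it. -/
lemma integrable_dampedFourier (hh : 0 < h) (hψ : Integrable ψ) :
    Integrable (dampedFourier h ψ) := by
  have hg : Integrable fun w : V => Real.exp (-(2 * Real.pi ^ 2 * h ^ 2) * ‖w‖ ^ 2) := by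
    have hb0 : 0 < (((2 * Real.pi ^ 2 * h ^ 2 : ℝ) : ℂ)).re := by
      rw [Complex.ofReal_re]; positivity
    have := (GaussianFourier.integrable_cexp_neg_mul_sq_norm_add hb0 0 (0 : V)).norm
    refine this.congr (Filter.Eventually.of_forall fun w => ?_)
    simp only [Complex.norm_exp]
    congr 1
    simp [← Complex.ofReal_pow]
  refine hg.ofReal.mul_bdd (c := ∫ x, ‖(ψ x : ℂ)‖)
    (continuous_fourier hψ.ofReal).aestronglyMeasurable (Filter.Eventually.of_forall fun w => ?_)
  exact VectorFourier.norm_fourierIntegral_le_integral_norm _ _ _ _ _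

lemma memLp_two_dampedFourier (hψ : Integrable ψ) (hψ2 : MemLp ψ 2 volume) :
    MemLp (dampedFourier h ψ) 2 volume :=
  (memLp_fourier hψ.ofReal hψ2.ofReal).of_le
    (continuous_dampedFourier hψ).aestronglyMeasurable
    (Filter.Eventually.of_forall fun w => norm_dampedFourier_le h ψ w)

/-- As ψ is real, reversing the sign of the frequency amounts to conjugation. -/
lemma fourierInv_ofReal (ψ : V → ℝ) (w : V) :
    𝓕⁻ (fun x => (ψ x : ℂ)) w = starRingEnd ℂ (𝓕 (fun x => (ψ x : ℂ)) w) := by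
  rw [Real.fourierInv_eq', Real.fourier_eq', ← integral_conj]
  refine integral_congr_ae (Filter.Eventually.of_forall fun x => ?_)
  simp only [smul_eq_mul, map_mul, Complex.conj_ofReal, ← Complex.exp_conj, Complex.conj_I]
  congr 2
  push_cast
  ring

/-- Parseval's identity for the quadratic form of a Gaussian convolution. -/
lemma integral_mul_integral_isoGaussian (hh : 0 < h) (hψ : Integrable ψ) :
    ∫ z, ψ z * ∫ t, isoGaussian h (z - t) * ψ t =
      ∫ w, Real.exp (-(2 * Real.pi ^ 2 * h ^ 2) * ‖w‖ ^ 2) *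
        ‖𝓕 (fun x => (ψ x : ℂ)) w‖ ^ 2 := by
  rw [← Complex.ofReal_inj, ← integral_complex_ofReal, ← integral_complex_ofReal]
  push_cast
  have e1 : ∀ z : V, (ψ z : ℂ) * ((∫ t, isoGaussian h (z - t) * ψ t : ℝ) : ℂ) =
      ψ z * 𝓕 (dampedFourier h ψ) (-z) := fun z => by
    rw [integral_isoGaussian_eq_fourierInv hh hψ, Real.fourierInv_eq_fourier_neg]
  -- The inverse transform at z is the transform at −z. The reflection z ↦ −z moves this sign onto
  -- ψ, where it turns the transform into its conjugate and produces the squared modulus.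
  have hneg : Integrable (fun x : V => (ψ (-x) : ℂ)) := (hψ.ofReal (𝕜 := ℂ)).comp_neg
  calc ∫ z, (ψ z : ℂ) * ((∫ t, isoGaussian h (z - t) * ψ t : ℝ) : ℂ)
      = ∫ z : V, (fun y : V => (ψ (-y) : ℂ) * 𝓕 (dampedFourier h ψ) y) (-z) := by
        simp only [e1, neg_neg]
    _ = ∫ y : V, (ψ (-y) : ℂ) * 𝓕 (dampedFourier h ψ) y :=
        integral_neg_eq_self (fun y : V => (ψ (-y) : ℂ) * 𝓕 (dampedFourier h ψ) y) volume
    _ = ∫ y, 𝓕 (fun x : V => (ψ (-x) : ℂ)) y * dampedFourier h ψ y :=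
        (integral_fourier_mul_eq hneg (integrable_dampedFourier hh hψ)).symm
    _ = _ := by
        refine integral_congr_ae (Filter.Eventually.of_forall fun w => ?_)
        have : 𝓕 (fun x : V => (ψ (-x) : ℂ)) w = starRingEnd ℂ (𝓕 (fun x => (ψ x : ℂ)) w) := by
          rw [← fourierInv_ofReal, Real.fourierInv_eq_fourier_comp_neg]
        simp only [this, dampedFourier]
        rw [mul_left_comm, ← Complex.normSq_eq_conj_mul_self, Complex.normSq_eq_norm_sq]
        push_cast
        rfl

/-- The squared `L²` norm of a Gaussian convolution is at most its quadratic form. -/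
lemma integral_sq_integral_isoGaussian_le (hh : 0 < h) (hψ : Integrable ψ)
    (hψ2 : MemLp ψ 2 volume) :
    ∫ z, (∫ t, isoGaussian h (z - t) * ψ t) ^ 2 ≤
      ∫ z, ψ z * ∫ t, isoGaussian h (z - t) * ψ t := by
  rw [integral_mul_integral_isoGaussian hh hψ]
  have e1 : ∀ z : V, (∫ t, isoGaussian h (z - t) * ψ t) ^ 2 =
      (fun y : V => ‖𝓕 (dampedFourier h ψ) y‖ ^ 2) (-z) := fun z => by
    simp only
    rw [← Real.fourierInv_eq_fourier_neg, ← integral_isoGaussian_eq_fourierInv hh hψ,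
      Complex.norm_real, Real.norm_eq_abs, sq_abs]
  simp only [e1]
  rw [integral_neg_eq_self (fun y : V => ‖𝓕 (dampedFourier h ψ) y‖ ^ 2),
    integral_sq_norm_fourier (integrable_dampedFourier hh hψ) (memLp_two_dampedFourier hψ hψ2)]
  have hF2 := (memLp_fourier hψ.ofReal hψ2.ofReal).integrable_norm_pow two_ne_zero
  refine integral_mono_of_nonneg (Filter.Eventually.of_forall fun w => by positivity)
    (hF2.mono' ?_ (Filter.Eventually.of_forall fun w => ?_))
    (Filter.Eventually.of_forall fun w => ?_)
  · have := continuous_fourier (hψ.ofReal (𝕜 := ℂ))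
    exact Continuous.aestronglyMeasurable (by fun_prop)
  · have : 0 ≤ 2 * Real.pi ^ 2 * h ^ 2 * ‖w‖ ^ 2 := by positivity
    rw [Real.norm_of_nonneg (by positivity)]
    exact mul_le_of_le_one_left (by positivity) (Real.exp_le_one_iff.2 (by linarith))
  · have : 0 ≤ 2 * Real.pi ^ 2 * h ^ 2 * ‖w‖ ^ 2 := by positivity
    simp only [dampedFourier, norm_mul, Complex.norm_real, Real.norm_eq_abs,
      abs_of_pos (Real.exp_pos _), mul_pow]
    refine mul_le_mul_of_nonneg_right ?_ (by positivity)
    -- The squared norm carries the square of the multiplier, the quadratic form its first power.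
    -- The multiplier lies in [0, 1], so squaring only decreases it.
    exact pow_le_of_le_one (Real.exp_pos _).le (Real.exp_le_one_iff.2 (by linarith)) two_ne_zero

end Fourier

/-! ### Approximation error on a Sobolev ball -/

section Sobolev

open scoped FourierTransform

/-- The two conventions for the phase, exp(i⟨x, u⟩) and exp(−2πi⟨x, w⟩), agree at u = −2πw. -/
lemma fourierHat_eq_fourier {d : ℕ} (s : E d → ℝ) (w : E d) :
    fourierHat s (-(2 * Real.pi) • w) = 𝓕 (fun x => (s x : ℂ)) w := by
  rw [fourierHat, Real.fourier_eq']
  refine integral_congr_ae (Filter.Eventually.of_forall fun x => ?_)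
  simp only [smul_eq_mul]
  rw [mul_comm, inner_smul_right]
  congr 2
  push_cast
  ring

lemma lintegral_comp_smul {V : Type*} [NormedAddCommGroup V] [NormedSpace ℝ V] [MeasurableSpace V]
    [BorelSpace V] [FiniteDimensional ℝ V] (μ : Measure V) [μ.IsAddHaarMeasure] {r : ℝ}
    (hr : r ≠ 0) (f : V → ℝ≥0∞) :
    ∫⁻ x, f (r • x) ∂μ = ENNReal.ofReal |(r ^ Module.finrank ℝ V)⁻¹| * ∫⁻ x, f x ∂μ := by
  have h := lintegral_map_equiv (μ := μ) f (Homeomorph.smulOfNeZero r hr).toMeasurableEquiv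
  have h2 : Measure.map (Homeomorph.smulOfNeZero r hr).toMeasurableEquiv μ =
      Measure.map (r • ·) μ := rfl
  rw [h2, Measure.map_addHaar_smul μ hr, lintegral_smul_measure] at h
  exact h.symm

/-- In terms of the unitary normalization, membership in a Sobolev ball bounds a weighted integral
of the Fourier transform. -/
lemma lintegral_fourier_le_of_mem_sobolevBall {d : ℕ} {δ R : ℝ} {s : E d → ℝ}
    (hs : s ∈ sobolevBall d δ R) :
    ∫⁻ w, ENNReal.ofReal ((2 * Real.pi * ‖w‖) ^ (2 * δ) * ‖𝓕 (fun x => (s x : ℂ)) w‖ ^ 2) ≤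
      ENNReal.ofReal (R ^ 2) := by
  have hpi : (0 : ℝ) < 2 * Real.pi := by positivity
  have h := lintegral_comp_smul (volume : Measure (E d)) (r := -(2 * Real.pi)) (by linarith)
    fun u => ENNReal.ofReal (‖u‖ ^ (2 * δ) * ‖fourierHat s u‖ ^ 2)
  simp only [fourierHat_eq_fourier, norm_smul, norm_neg, Real.norm_of_nonneg hpi.le] at h
  rw [h]
  -- The Jacobian of u = −2πw; it cancels the factor (2π)^d in the definition of the ball.
  have habs : |((-(2 * Real.pi)) ^ Module.finrank ℝ (E d))⁻¹| = ((2 * Real.pi) ^ d)⁻¹ := by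
    rw [abs_inv, abs_pow, abs_neg, abs_of_pos hpi]
    simp
  rw [habs]
  calc _ ≤ ENNReal.ofReal (((2 * Real.pi) ^ d)⁻¹) *
        ENNReal.ofReal ((2 * Real.pi) ^ d * R ^ 2) := by gcongr; exact hs.2.2
    _ = ENNReal.ofReal (R ^ 2) := by
        rw [← ENNReal.ofReal_mul (by positivity)]
        congr 1
        field_simp

/-- The quadratic form of a Gaussian convolution controls the `L²` norm on a Sobolev ball, up to
the approximation error at the scale of the Gaussian. -/
lemma integral_sq_le_of_mem_sobolevBall {d : ℕ} {δ R h : ℝ} (hδ : 0 < δ) (hh : 0 < h)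
    {s : E d → ℝ} (hs : s ∈ sobolevBall d δ R) :
    ∫ x, s x ^ 2 ≤ Real.exp (1 / 2) * (∫ z, s z * ∫ t, isoGaussian h (z - t) * s t) +
      h ^ (2 * δ) * R ^ 2 := by
  have hs1 : Integrable s := memLp_one_iff_integrable.1 hs.1
  have hs1' : Integrable fun x => (s x : ℂ) := hs1.ofReal
  have hs2 : MemLp s 2 volume := hs.2.1
  have hs2' : MemLp (fun x => (s x : ℂ)) 2 volume := hs2.ofReal
  have hpl : ∫ x, s x ^ 2 = ∫ w, ‖𝓕 (fun x => (s x : ℂ)) w‖ ^ 2 := by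
    rw [integral_sq_norm_fourier hs1' hs2']
    simp
  have hc : Continuous (𝓕 (fun x => (s x : ℂ))) := continuous_fourier hs1'
  have hF2 := (memLp_fourier hs1' hs2').integrable_norm_pow two_ne_zero
  simp only at hF2
  rw [hpl, integral_mul_integral_isoGaussian hh hs1]
  set F := 𝓕 (fun x => (s x : ℂ)) with hF
  have hle := lintegral_fourier_le_of_mem_sobolevBall hs
  rw [← hF] at hle
  have hmeas : AEStronglyMeasurable (fun w => (2 * Real.pi * ‖w‖) ^ (2 * δ) * ‖F w‖ ^ 2)
      (volume : Measure (E d)) := by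
    refine Continuous.aestronglyMeasurable ((Continuous.rpow_const (by fun_prop) fun w => ?_).mul
      (by fun_prop))
    exact Or.inr (by positivity)
  have hnn : ∀ w, 0 ≤ (2 * Real.pi * ‖w‖) ^ (2 * δ) * ‖F w‖ ^ 2 := fun w => by positivity
  have hWi : Integrable (fun w => (2 * Real.pi * ‖w‖) ^ (2 * δ) * ‖F w‖ ^ 2) := by
    refine ⟨hmeas, ?_⟩
    rw [hasFiniteIntegral_iff_ofReal (Filter.Eventually.of_forall hnn)]
    exact hle.trans_lt ENNReal.ofReal_lt_top
  have hWle : ∫ w, (2 * Real.pi * ‖w‖) ^ (2 * δ) * ‖F w‖ ^ 2 ≤ R ^ 2 := by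
    rw [integral_eq_lintegral_of_nonneg_ae (Filter.Eventually.of_forall hnn) hmeas]
    exact ENNReal.toReal_le_of_le_ofReal (sq_nonneg _) hle
  have hGi : Integrable fun w => Real.exp (-(2 * Real.pi ^ 2 * h ^ 2) * ‖w‖ ^ 2) * ‖F w‖ ^ 2 := by
    refine hF2.mono' (Continuous.aestronglyMeasurable (by fun_prop))
      (Filter.Eventually.of_forall fun w => ?_)
    have : 0 ≤ 2 * Real.pi ^ 2 * h ^ 2 * ‖w‖ ^ 2 := by positivity
    rw [Real.norm_of_nonneg (by positivity)]
    exact mul_le_of_le_one_left (by positivity) (Real.exp_le_one_iff.2 (by linarith))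
  have hpt : ∀ w : E d, ‖F w‖ ^ 2 ≤
      Real.exp (1 / 2) * (Real.exp (-(2 * Real.pi ^ 2 * h ^ 2) * ‖w‖ ^ 2) * ‖F w‖ ^ 2) +
        h ^ (2 * δ) * ((2 * Real.pi * ‖w‖) ^ (2 * δ) * ‖F w‖ ^ 2) := by
    intro w
    -- With τ = 2πh‖w‖ the multiplier is exp(−τ²/2). For τ ≤ 1 it is at least exp(−1/2), so the
    -- first term suffices; for τ ≥ 1 the second term τ^(2δ) is at least 1.
    have h1 : 1 ≤ Real.exp (1 / 2) * Real.exp (-(2 * Real.pi ^ 2 * h ^ 2) * ‖w‖ ^ 2) +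
        h ^ (2 * δ) * (2 * Real.pi * ‖w‖) ^ (2 * δ) := by
      rw [← Real.exp_add, ← Real.mul_rpow hh.le (by positivity)]
      rcases le_total (h * (2 * Real.pi * ‖w‖)) 1 with hw | hw
      · have : (h * (2 * Real.pi * ‖w‖)) ^ 2 ≤ 1 := pow_le_one₀ (by positivity) hw
        have h2 : 1 ≤ Real.exp (1 / 2 + -(2 * Real.pi ^ 2 * h ^ 2) * ‖w‖ ^ 2) :=
          Real.one_le_exp (by nlinarith)
        have h3 : 0 ≤ (h * (2 * Real.pi * ‖w‖)) ^ (2 * δ) := by positivity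
        linarith
      · have h2 := Real.one_le_rpow hw (by positivity : 0 ≤ 2 * δ)
        have h3 := Real.exp_pos (1 / 2 + -(2 * Real.pi ^ 2 * h ^ 2) * ‖w‖ ^ 2)
        linarith
    have h4 := mul_le_mul_of_nonneg_right h1 (sq_nonneg ‖F w‖)
    linarith
  calc ∫ w, ‖F w‖ ^ 2 ≤ ∫ w : E d, (Real.exp (1 / 2) *
        (Real.exp (-(2 * Real.pi ^ 2 * h ^ 2) * ‖w‖ ^ 2) * ‖F w‖ ^ 2) +
        h ^ (2 * δ) * ((2 * Real.pi * ‖w‖) ^ (2 * δ) * ‖F w‖ ^ 2)) :=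
        integral_mono hF2 ((hGi.const_mul _).fun_add (hWi.const_mul _)) hpt
    _ = Real.exp (1 / 2) * (∫ w : E d,
          Real.exp (-(2 * Real.pi ^ 2 * h ^ 2) * ‖w‖ ^ 2) * ‖F w‖ ^ 2) +
        h ^ (2 * δ) * ∫ w, (2 * Real.pi * ‖w‖) ^ (2 * δ) * ‖F w‖ ^ 2 := by
        rw [integral_add (hGi.const_mul _) (hWi.const_mul _), integral_const_mul,
          integral_const_mul]
    _ ≤ _ := by gcongr

end Sobolev

/-! ### Densities, their marginals and the dependence ψ -/

section density

variable {p q : ℕ} {f : E p × E q → ℝ}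

/-- The distribution with density `f`. -/
noncomputable def densityMeasure (f : E p × E q → ℝ) : Measure (E p × E q) :=
  volume.withDensity fun z => ENNReal.ofReal (f z)

lemma IsDensity.isProbabilityMeasure (hf : IsDensity f) :
    IsProbabilityMeasure (densityMeasure f) := by
  refine ⟨?_⟩
  rw [densityMeasure, withDensity_apply _ MeasurableSet.univ, Measure.restrict_univ]
  exact hf.lintegral_eq_one

lemma IsDensity.integrable (hf : IsDensity f) : Integrable f := by
  refine ⟨hf.measurable.aestronglyMeasurable, ?_⟩
  rw [hasFiniteIntegral_iff_ofReal (Filter.Eventually.of_forall hf.nonneg), hf.lintegral_eq_one]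
  exact ENNReal.one_lt_top

lemma IsDensity.integral_eq_one (hf : IsDensity f) : ∫ z, f z = 1 := by
  rw [integral_eq_lintegral_of_nonneg_ae (Filter.Eventually.of_forall hf.nonneg)
    hf.measurable.aestronglyMeasurable, hf.lintegral_eq_one, ENNReal.toReal_one]

lemma IsDensity.integral_densityMeasure (hf : IsDensity f) (φ : E p × E q → ℝ) :
    ∫ z, φ z ∂(densityMeasure f) = ∫ z, f z * φ z := by
  rw [densityMeasure, integral_withDensity_eq_integral_toReal_smul
    hf.measurable.ennreal_ofReal (Filter.Eventually.of_forall fun _ => ENNReal.ofReal_lt_top)]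
  simp only [ENNReal.toReal_ofReal (hf.nonneg _), smul_eq_mul]

lemma IsDensity.marginalFst_nonneg (hf : IsDensity f) (x : E p) : 0 ≤ marginalFst f x :=
  integral_nonneg fun _ => hf.nonneg _

lemma IsDensity.marginalSnd_nonneg (hf : IsDensity f) (y : E q) : 0 ≤ marginalSnd f y :=
  integral_nonneg fun _ => hf.nonneg _

lemma IsDensity.measurable_marginalFst (hf : IsDensity f) : Measurable (marginalFst f) :=
  (hf.measurable.stronglyMeasurable.integral_prod_right').measurable

lemma IsDensity.measurable_marginalSnd (hf : IsDensity f) : Measurable (marginalSnd f) :=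
  (hf.measurable.stronglyMeasurable.integral_prod_left').measurable

lemma IsDensity.integrable_marginalFst (hf : IsDensity f) : Integrable (marginalFst f) :=
  Integrable.integral_prod_left (μ := volume) (ν := volume) hf.integrable

lemma IsDensity.integrable_marginalSnd (hf : IsDensity f) : Integrable (marginalSnd f) :=
  Integrable.integral_prod_right (μ := volume) (ν := volume) hf.integrable

lemma IsDensity.integral_marginalFst (hf : IsDensity f) : ∫ x, marginalFst f x = 1 := by
  rw [← hf.integral_eq_one]
  exact (integral_prod (μ := volume) (ν := volume) f hf.integrable).symm

lemma IsDensity.integral_marginalSnd (hf : IsDensity f) : ∫ y, marginalSnd f y = 1 := by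
  rw [← hf.integral_eq_one]
  exact (integral_prod_symm (μ := volume) (ν := volume) f hf.integrable).symm

lemma IsDensity.integrable_prodMarginals (hf : IsDensity f) : Integrable (prodMarginals f) :=
  Integrable.mul_prod (μ := volume) (ν := volume) hf.integrable_marginalFst
    hf.integrable_marginalSnd

lemma IsDensity.integral_prodMarginals (hf : IsDensity f) : ∫ z, prodMarginals f z = 1 := by
  have := integral_prod_mul (μ := volume) (ν := volume) (marginalFst f) (marginalSnd f)
  rw [hf.integral_marginalFst, hf.integral_marginalSnd, mul_one] at this
  exact this

/-- The product of the marginals is a density. -/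
lemma IsDensity.isDensity_prodMarginals (hf : IsDensity f) : IsDensity (prodMarginals f) where
  measurable := (hf.measurable_marginalFst.comp measurable_fst).mul
    (hf.measurable_marginalSnd.comp measurable_snd)
  nonneg z := mul_nonneg (hf.marginalFst_nonneg _) (hf.marginalSnd_nonneg _)
  lintegral_eq_one := by
    rw [← ofReal_integral_eq_lintegral_ofReal hf.integrable_prodMarginals
      (Filter.Eventually.of_forall fun z => mul_nonneg (hf.marginalFst_nonneg _)
        (hf.marginalSnd_nonneg _)), hf.integral_prodMarginals, ENNReal.ofReal_one]

lemma IsDensity.marginalFst_prodMarginals (hf : IsDensity f) :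
    marginalFst (prodMarginals f) = marginalFst f := by
  ext x
  simp only [marginalFst, prodMarginals]
  rw [integral_const_mul, hf.integral_marginalSnd, mul_one]

lemma IsDensity.marginalSnd_prodMarginals (hf : IsDensity f) :
    marginalSnd (prodMarginals f) = marginalSnd f := by
  ext y
  simp only [marginalSnd, prodMarginals]
  rw [integral_mul_const, hf.integral_marginalFst, one_mul]

/-- Independence becomes the case ψ = 0 of the general estimates, so one variance bound serves both
for the critical value and for the alternative. -/
lemma IsDensity.dependence_prodMarginals (hf : IsDensity f) :
    dependence (prodMarginals f) = 0 := by
  ext z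
  simp only [dependence]
  rw [show prodMarginals (prodMarginals f) z = prodMarginals f z by
    rw [prodMarginals, hf.marginalFst_prodMarginals, hf.marginalSnd_prodMarginals]; rfl]
  exact sub_self _

variable {A : ℝ}

lemma IsDensity.integral_comp_fst (hf : IsDensity f) {φ : E p → ℝ} (hφ : Measurable φ)
    (hA : ∀ x, |φ x| ≤ A) :
    ∫ z, φ z.1 ∂(densityMeasure f) = ∫ x, marginalFst f x * φ x := by
  have hi : Integrable (fun z : E p × E q => f z * φ z.1) :=
    hf.integrable.mul_bdd (hφ.comp measurable_fst).aestronglyMeasurable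
      (Filter.Eventually.of_forall fun z => hA z.1)
  rw [hf.integral_densityMeasure]
  refine (integral_prod (μ := volume) (ν := volume) _ hi).trans ?_
  simp only [integral_mul_const]
  rfl

lemma IsDensity.integral_comp_snd (hf : IsDensity f) {φ : E q → ℝ} (hφ : Measurable φ)
    (hA : ∀ y, |φ y| ≤ A) :
    ∫ z, φ z.2 ∂(densityMeasure f) = ∫ y, marginalSnd f y * φ y := by
  have hi : Integrable (fun z : E p × E q => f z * φ z.2) :=
    hf.integrable.mul_bdd (hφ.comp measurable_snd).aestronglyMeasurable
      (Filter.Eventually.of_forall fun z => hA z.2)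
  rw [hf.integral_densityMeasure]
  refine (integral_prod_symm (μ := volume) (ν := volume) _ hi).trans ?_
  simp only [integral_mul_const]
  rfl

/-- The coordinates of two independent observations follow the product of the marginals. -/
lemma IsDensity.integral_prod_densityMeasure (hf : IsDensity f) {φ : E p × E q → ℝ}
    (hφ : Measurable φ) (hA : ∀ z, |φ z| ≤ A) :
    ∫ a, φ (a.1.1, a.2.2) ∂((densityMeasure f).prod (densityMeasure f)) =
      ∫ z, prodMarginals f z * φ z := by
  have := hf.isProbabilityMeasure
  have hi : Integrable (fun a : (E p × E q) × (E p × E q) => φ (a.1.1, a.2.2))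
      ((densityMeasure f).prod (densityMeasure f)) :=
    integrable_of_abs_le (by fun_prop) fun a => hA _
  have hi' : Integrable (fun z : E p × E q => prodMarginals f z * φ z) :=
    hf.integrable_prodMarginals.mul_bdd hφ.aestronglyMeasurable (Filter.Eventually.of_forall hA)
  have hm : Measurable fun x : E p => ∫ b, φ (x, b.2) ∂(densityMeasure f) :=
    (StronglyMeasurable.integral_prod_right' (ν := densityMeasure f)
      (f := fun a : E p × (E p × E q) => φ (a.1, a.2.2))
      (hφ.comp (by fun_prop : Measurable fun a : E p × (E p × E q) =>
        (a.1, a.2.2))).stronglyMeasurable).measurable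
  rw [integral_prod _ hi]
  rw [hf.integral_comp_fst (φ := fun x => ∫ b, φ (x, b.2) ∂(densityMeasure f)) hm
    fun x => abs_integral_le fun b => hA _]
  refine Eq.trans ?_ (integral_prod (μ := volume) (ν := volume) _ hi').symm
  refine integral_congr_ae (Filter.Eventually.of_forall fun x => ?_)
  simp only
  rw [hf.integral_comp_snd (φ := fun y => φ (x, y)) (hφ.comp measurable_prodMk_left)
    fun y => hA _, ← integral_const_mul]
  simp only [prodMarginals, mul_assoc]

/-- The covariance of the kernels is the convolution of the kernels with `f - f₁ ⊗ f₂`. -/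
lemma IsDensity.kernelCov_eq (hf : IsDensity f) {K : E p → E p → ℝ} {L : E q → E q → ℝ}
    (hK : Measurable (Function.uncurry K)) (hL : Measurable (Function.uncurry L)) {B : ℝ}
    (hKA : ∀ x y, |K x y| ≤ A) (hLB : ∀ x y, |L x y| ≤ B) (z : E p × E q) :
    kernelCov K L (densityMeasure f) z = ∫ u, K z.1 u.1 * L z.2 u.2 * dependence f u := by
  have hKm : Measurable (K z.1) := hK.comp measurable_prodMk_left
  have hLm : Measurable (L z.2) := hL.comp measurable_prodMk_left
  have hKLm : Measurable fun u : E p × E q => K z.1 u.1 * L z.2 u.2 :=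
    (hKm.comp measurable_fst).mul (hLm.comp measurable_snd)
  have hKL : ∀ u : E p × E q, ‖K z.1 u.1 * L z.2 u.2‖ ≤ A * B := fun u => by
    rw [norm_mul]
    exact mul_le_mul (hKA _ _) (hLB _ _) (abs_nonneg _) ((abs_nonneg _).trans (hKA z.1 z.1))
  have i1 : Integrable fun u : E p × E q => f u * (K z.1 u.1 * L z.2 u.2) :=
    hf.integrable.mul_bdd hKLm.aestronglyMeasurable (Filter.Eventually.of_forall hKL)
  have i2 : Integrable fun u : E p × E q =>
      prodMarginals f u * (K z.1 u.1 * L z.2 u.2) :=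
    hf.integrable_prodMarginals.mul_bdd hKLm.aestronglyMeasurable
      (Filter.Eventually.of_forall hKL)
  have e1 : (∫ x, marginalFst f x * K z.1 x) * ∫ y, marginalSnd f y * L z.2 y =
      ∫ u : E p × E q, prodMarginals f u * (K z.1 u.1 * L z.2 u.2) := by
    rw [← integral_prod_mul]
    refine integral_congr_ae (Filter.Eventually.of_forall fun u => ?_)
    simp only [prodMarginals]
    ring
  rw [kernelCov, hf.integral_densityMeasure, hf.integral_comp_fst hKm (hKA z.1),
    hf.integral_comp_snd hLm (hLB z.2), e1, ← integral_sub i1 i2]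
  refine integral_congr_ae (Filter.Eventually.of_forall fun u => ?_)
  simp only [dependence]
  ring

end density

/-! ### Identification of ℝ^(p+q) with ℝ^p × ℝ^q -/

section transfer

variable {p q : ℕ}

/-- The map is a composition of isometries onto the L² product, followed by the change from the L²
norm to the sup norm, which preserves volume but not the norm. -/
lemma measurePreserving_finAddEquivProd :
    MeasurePreserving (EuclideanSpace.finAddEquivProd : E (p + q) ≃L[ℝ] E p × E q) :=
  (WithLp.volume_preserving_ofLp (E p) (E q)).comp
    ((LinearIsometryEquiv.measurePreserving (PiLp.sumPiLpEquivProdLpPiLp 2 fun _ => ℝ)).comp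
      (LinearIsometryEquiv.measurePreserving
        (LinearIsometryEquiv.piLpCongrLeft 2 ℝ ℝ finSumFinEquiv.symm)))

lemma norm_sq_finAddEquivProd (w : E (p + q)) :
    ‖w‖ ^ 2 = ‖(EuclideanSpace.finAddEquivProd w).1‖ ^ 2 +
      ‖(EuclideanSpace.finAddEquivProd w).2‖ ^ 2 := by
  have h1 := (LinearIsometryEquiv.piLpCongrLeft 2 ℝ ℝ
    (finSumFinEquiv (m := p) (n := q)).symm).norm_map w
  have h2 := (PiLp.sumPiLpEquivProdLpPiLp (𝕜 := ℝ) 2 fun _ : Fin p ⊕ Fin q => ℝ).norm_map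
    (LinearIsometryEquiv.piLpCongrLeft 2 ℝ ℝ finSumFinEquiv.symm w)
  rw [← h1, ← h2, WithLp.prod_norm_sq_eq_of_L2]
  rfl

lemma scaledGaussian_const_eq_isoGaussian {d : ℕ} {h : ℝ} (hh : 0 < h) (x : E d) :
    scaledGaussian (fun _ => h) x = isoGaussian h x := by
  rw [scaledGaussian, stdGaussian, isoGaussian, EuclideanSpace.norm_sq_eq, ← mul_assoc]
  congr 1
  · have h1 : (h ^ 2) ^ ((d : ℝ) / 2) = h ^ d := by
      rw [← Real.rpow_natCast h 2, ← Real.rpow_mul hh.le]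
      push_cast
      rw [mul_div_cancel₀ _ two_ne_zero, Real.rpow_natCast]
    rw [Real.div_rpow zero_le_one (by positivity),
      Real.mul_rpow (x := 2 * Real.pi) (y := h ^ 2) (by positivity) (by positivity)]
    simp only [finrank_euclideanSpace, Fintype.card_fin, Real.one_rpow, Finset.prod_const,
      Finset.card_univ]
    rw [h1]
    field_simp
  · congr 1
    simp only [Real.norm_eq_abs, sq_abs, div_pow]
    rw [← Finset.sum_div]
    field_simp

lemma isoGaussian_finAddEquivProd {h : ℝ} (hh : 0 < h) (w : E (p + q)) :
    isoGaussian h w = isoGaussian h (EuclideanSpace.finAddEquivProd w).1 *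
      isoGaussian h (EuclideanSpace.finAddEquivProd w).2 := by
  simp only [isoGaussian, finrank_euclideanSpace, Fintype.card_fin]
  rw [mul_mul_mul_comm, ← Real.rpow_add (by positivity), ← Real.exp_add, norm_sq_finAddEquivProd w]
  congr 2
  · push_cast; ring
  · ring

lemma integral_isoGaussian {d : ℕ} {h : ℝ} (hh : 0 < h) :
    Integrable (isoGaussian h : E d → ℝ) ∧ ∫ t : E d, isoGaussian h t = 1 := by
  have hb : 0 < 1 / (2 * h ^ 2) := by positivity
  have e : (isoGaussian h : E d → ℝ) = fun t => (1 / (2 * Real.pi * h ^ 2)) ^ ((d : ℝ) / 2) *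
      Real.exp (-(1 / (2 * h ^ 2)) * ‖t‖ ^ 2) := by
    ext t
    simp only [isoGaussian, finrank_euclideanSpace, Fintype.card_fin]
    congr 2
    ring
  have hint := GaussianFourier.integral_rexp_neg_mul_sq_norm (V := E d) hb
  have hval : ∫ t : E d, isoGaussian h t = 1 := by
    rw [e, integral_const_mul, hint]
    simp only [finrank_euclideanSpace, Fintype.card_fin]
    rw [← Real.mul_rpow (by positivity) (by positivity)]
    convert Real.one_rpow ((d : ℝ) / 2) using 2
    field_simp
  refine ⟨?_, hval⟩
  -- A non-integrable function has integral 0 by convention, so the value 1 forces integrability.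
  by_contra hni
  rw [integral_undef hni] at hval
  exact zero_ne_one hval

end transfer

/-! ### The HSIC measure and the variance bound for a common bandwidth -/

section isotropic

open scoped FourierTransform

/-- One factor of the square is bounded by the supremum h^(-d) of the kernel; the other has mass
one. -/
lemma integral_sq_gaussKernel_le {d : ℕ} {h : ℝ} (hh : 0 < h) (x : E d) :
    Integrable (fun y => gaussKernel (fun _ => h) x y ^ 2) ∧
      ∫ y, gaussKernel (fun _ => h) x y ^ 2 ≤ (h ^ d)⁻¹ := by
  obtain ⟨hi, hone⟩ := integral_isoGaussian (d := d) hh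
  have e : ∀ y, gaussKernel (fun _ => h) x y = isoGaussian h (x - y) := fun y =>
    scaledGaussian_const_eq_isoGaussian hh _
  have hi' : Integrable fun y => isoGaussian h (x - y) := hi.comp_sub_left x
  have hle : ∀ y, gaussKernel (fun _ => h) x y ^ 2 ≤ (h ^ d)⁻¹ * isoGaussian h (x - y) :=
    fun y => by
      rw [sq, ← e]
      refine mul_le_mul_of_nonneg_right ?_ (gaussKernel_nonneg (fun _ => hh) x y)
      simpa using gaussKernel_le (b := fun _ : Fin d => h) (fun _ => hh) x y
  have hm : Measurable fun y => gaussKernel (fun _ => h) x y ^ 2 :=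
    ((measurable_gaussKernel _).comp measurable_prodMk_left).pow_const 2
  have hint : Integrable (fun y => gaussKernel (fun _ => h) x y ^ 2) :=
    (hi'.const_mul _).mono' hm.aestronglyMeasurable
      (Filter.Eventually.of_forall fun y => by
        rw [Real.norm_of_nonneg (sq_nonneg _)]; exact hle y)
  refine ⟨hint, (integral_mono hint (hi'.const_mul _) hle).trans_eq ?_⟩
  rw [integral_const_mul, integral_sub_left_eq_self (isoGaussian h) volume x, hone, mul_one]

lemma integrable_sq_integral_isoGaussian {d : ℕ} {h : ℝ} (hh : 0 < h) {s : E d → ℝ}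
    (hs : Integrable s) (hs2 : MemLp s 2 volume) :
    Integrable fun z => (∫ t, isoGaussian h (z - t) * s t) ^ 2 := by
  have h1 := ((memLp_fourier (integrable_dampedFourier hh hs)
    (memLp_two_dampedFourier (h := h) hs hs2)).integrable_norm_pow two_ne_zero).comp_neg
  refine h1.congr (Filter.Eventually.of_forall fun z => ?_)
  simp only
  rw [← Real.fourierInv_eq_fourier_neg, ← integral_isoGaussian_eq_fourierInv hh hs,
    Complex.norm_real, Real.norm_eq_abs, sq_abs]

variable {p q : ℕ}

/-- `f - f₁ ⊗ f₂` as a function on `ℝ^(p+q)`. -/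
noncomputable def dependenceSum (f : E p × E q → ℝ) (w : E (p + q)) : ℝ :=
  dependence f (EuclideanSpace.finAddEquivProd w)

/-- The HSIC measure of `f` for Gaussian kernels with common bandwidth `h`. -/
noncomputable def hsicMeasure (h : ℝ) (f : E p × E q → ℝ) : ℝ :=
  ∫ z, dependenceSum f z * ∫ t, isoGaussian h (z - t) * dependenceSum f t

lemma integral_comp_finAddEquivProd (φ : E p × E q → ℝ) :
    ∫ w : E (p + q), φ (EuclideanSpace.finAddEquivProd w) = ∫ z, φ z :=
  measurePreserving_finAddEquivProd.integral_comp
    (EuclideanSpace.finAddEquivProd (𝕜 := ℝ)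
      (n := p) (m := q)).toHomeomorph.measurableEmbedding φ

variable {f : E p × E q → ℝ} {h : ℝ}

lemma abs_gaussKernel_le {d : ℕ} (hh : 0 < h) (x y : E d) :
    |gaussKernel (fun _ => h) x y| ≤ (∏ _i : Fin d, h)⁻¹ := by
  rw [abs_of_nonneg (gaussKernel_nonneg (fun _ => hh) x y)]
  exact gaussKernel_le (fun _ => hh) x y

/-- With the same bandwidth in both spaces, the product of the two kernels is an isotropic Gaussian
on ℝ^(p+q), so the covariance function is a single Gaussian convolution of ψ and the Fourier
estimates apply. -/
lemma IsDensity.kernelCov_finAddEquivProd (hf : IsDensity f) (hh : 0 < h) (w : E (p + q)) :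
    kernelCov (gaussKernel fun _ => h) (gaussKernel fun _ => h) (densityMeasure f)
        (EuclideanSpace.finAddEquivProd w) =
      ∫ t, isoGaussian h (w - t) * dependenceSum f t := by
  rw [hf.kernelCov_eq (measurable_gaussKernel _) (measurable_gaussKernel _)
    (abs_gaussKernel_le hh) (abs_gaussKernel_le hh), ← integral_comp_finAddEquivProd]
  refine integral_congr_ae (Filter.Eventually.of_forall fun t => ?_)
  simp only [gaussKernel, scaledGaussian_const_eq_isoGaussian hh, dependenceSum]
  rw [isoGaussian_finAddEquivProd hh, map_sub]
  rfl

lemma IsDensity.integrable_dependenceSum (hf : IsDensity f) : Integrable (dependenceSum f) :=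
  (measurePreserving_finAddEquivProd.integrable_comp_emb
    (EuclideanSpace.finAddEquivProd (𝕜 := ℝ)
      (n := p) (m := q)).toHomeomorph.measurableEmbedding).2
    (hf.integrable.sub hf.integrable_prodMarginals)

/-- The HSIC statistic is an unbiased estimator of the HSIC measure. -/
lemma IsDensity.integral_integral_quadKernel_eq (hf : IsDensity f) (hh : 0 < h) :
    ∫ a, ∫ b, quadKernel (gaussKernel fun _ => h) (gaussKernel fun _ => h) a b
        ∂((densityMeasure f).prod (densityMeasure f))
        ∂((densityMeasure f).prod (densityMeasure f)) = hsicMeasure h f := by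
  have := hf.isProbabilityMeasure
  have hK : ∀ {d : ℕ} (x y : E d), 0 ≤ gaussKernel (fun _ => h) x y ∧
      gaussKernel (fun _ => h) x y ≤ (∏ _i : Fin d, h)⁻¹ := fun x y =>
    ⟨gaussKernel_nonneg (fun _ => hh) x y, gaussKernel_le (fun _ => hh) x y⟩
  have hGm := measurable_kernelCov (measurable_gaussKernel fun _ : Fin p => h)
    (measurable_gaussKernel fun _ : Fin q => h) (densityMeasure f)
  have hGb := abs_kernelCov_le (densityMeasure f) (hK (d := p)) (hK (d := q))
  -- The expectation is the mean of k ∗ ψ under f minus its mean under f₁ ⊗ f₂, which is its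
  -- integral against ψ.
  rw [integral_integral_quadKernel _ (measurable_gaussKernel _) (measurable_gaussKernel _) hK hK,
    hf.integral_densityMeasure, hf.integral_prod_densityMeasure hGm hGb,
    ← integral_sub (hf.integrable.mul_bdd hGm.aestronglyMeasurable
      (Filter.Eventually.of_forall hGb))
      (hf.integrable_prodMarginals.mul_bdd hGm.aestronglyMeasurable
        (Filter.Eventually.of_forall hGb)), ← integral_comp_finAddEquivProd, hsicMeasure]
  refine integral_congr_ae (Filter.Eventually.of_forall fun w => ?_)
  simp only [hf.kernelCov_finAddEquivProd hh, dependenceSum, dependence]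
  ring

variable {M M₁ M₂ : ℝ}

lemma IsDensity.prodMarginals_le (hf : IsDensity f) (h1 : ∀ᵐ x, marginalFst f x ≤ M₁)
    (h2 : ∀ᵐ y, marginalSnd f y ≤ M₂) : ∀ᵐ z, prodMarginals f z ≤ M₁ * M₂ := by
  have h1' : ∀ᵐ z : E p × E q, marginalFst f z.1 ≤ M₁ :=
    Measure.quasiMeasurePreserving_fst.ae h1
  have h2' : ∀ᵐ z : E p × E q, marginalSnd f z.2 ≤ M₂ :=
    Measure.quasiMeasurePreserving_snd.ae h2
  filter_upwards [h1', h2'] with z hz1 hz2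
  exact mul_le_mul hz1 hz2 (hf.marginalSnd_nonneg _) ((hf.marginalFst_nonneg _).trans hz1)

lemma integral_mul_sq_le {g : E p × E q → ℝ} {G : E p × E q → ℝ} (hg0 : ∀ z, 0 ≤ g z)
    (hg : ∀ᵐ z, g z ≤ M) (hG : Integrable fun z => G z ^ 2) :
    ∫ z, g z * G z ^ 2 ≤ M * ∫ z, G z ^ 2 := by
  rw [← integral_const_mul]
  refine integral_mono_of_nonneg (Filter.Eventually.of_forall fun z =>
    mul_nonneg (hg0 z) (sq_nonneg _)) (hG.const_mul _) ?_
  filter_upwards [hg] with z hz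
  exact mul_le_mul_of_nonneg_right hz (sq_nonneg _)

/-- The mean squared error of the HSIC statistic for a bounded density. -/
lemma IsDensity.integral_sq_hsicStat_sub_le (hf : IsDensity f) (hh : 0 < h)
    (hs2 : MemLp (dependenceSum f) 2 volume) (hM : ∀ᵐ z, f z ≤ M) (hM0 : 0 ≤ M)
    (h1 : ∀ᵐ x, marginalFst f x ≤ M₁) (hM1 : 0 ≤ M₁)
    (h2 : ∀ᵐ y, marginalSnd f y ≤ M₂) (hM2 : 0 ≤ M₂) {n m : ℕ} (hm : 0 < m) (hmn : 4 * m ≤ n) :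
    ∫ z, (hsicStat (fun _ => h) (fun _ => h) z - hsicMeasure h f) ^ 2 ∂(sampleLaw n f) ≤
      4 * (M + M₁ * M₂) * (m : ℝ)⁻¹ * hsicMeasure h f +
        8 * (M + M₁ * M₂) * ((m : ℝ)⁻¹ ^ 2 * (h ^ (p + q))⁻¹) := by
  have := hf.isProbabilityMeasure
  set K : E p → E p → ℝ := gaussKernel fun _ => h
  set L : E q → E q → ℝ := gaussKernel fun _ => h
  have hKm : Measurable (Function.uncurry K) := measurable_gaussKernel _
  have hLm : Measurable (Function.uncurry L) := measurable_gaussKernel _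
  have hKb : ∀ x y, 0 ≤ K x y ∧ K x y ≤ (∏ _i : Fin p, h)⁻¹ := fun x y =>
    ⟨gaussKernel_nonneg (fun _ => hh) x y, gaussKernel_le (fun _ => hh) x y⟩
  have hLb : ∀ x y, 0 ≤ L x y ∧ L x y ≤ (∏ _i : Fin q, h)⁻¹ := fun x y =>
    ⟨gaussKernel_nonneg (fun _ => hh) x y, gaussKernel_le (fun _ => hh) x y⟩
  set ν := densityMeasure f
  set G := kernelCov K L ν
  have hGm : Measurable G := measurable_kernelCov hKm hLm ν
  have hGb : ∀ z, |G z ^ 2| ≤ (2 * ((∏ _i : Fin p, h)⁻¹ * (∏ _i : Fin q, h)⁻¹)) ^ 2 :=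
    fun z => by
      rw [abs_pow]
      gcongr
      exact abs_kernelCov_le ν hKb hLb z
  have hGι : ∀ w : E (p + q), G (EuclideanSpace.finAddEquivProd w) =
      ∫ t, isoGaussian h (w - t) * dependenceSum f t := hf.kernelCov_finAddEquivProd hh
  have hs := hf.integrable_dependenceSum
  have hGi : Integrable fun z => G z ^ 2 := by
    refine (measurePreserving_finAddEquivProd.integrable_comp_emb
      (EuclideanSpace.finAddEquivProd (𝕜 := ℝ)
        (n := p) (m := q)).toHomeomorph.measurableEmbedding).1 ?_
    refine (integrable_sq_integral_isoGaussian hh hs hs2).congr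
      (Filter.Eventually.of_forall fun w => ?_)
    simp only [Function.comp_apply, hGι]
  -- This makes the linear part of the variance proportional to θ, hence small compared with θ² as
  -- soon as θ is large compared with 1/m.
  have hGint : ∫ z, G z ^ 2 ≤ hsicMeasure h f := by
    rw [← integral_comp_finAddEquivProd]
    simp only [hGι]
    exact integral_sq_integral_isoGaussian_le hh hs hs2
  have hproj : ∫ a, (∫ b, quadKernel K L a b ∂(ν.prod ν)) ^ 2 ∂(ν.prod ν) ≤
      2 * ((M + M₁ * M₂) * hsicMeasure h f) := by
    refine (integral_sq_integral_quadKernel_le ν hKm hLm hKb hLb).trans ?_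
    rw [hf.integral_densityMeasure,
      hf.integral_prod_densityMeasure (φ := fun z => G z ^ 2) (hGm.pow_const 2) hGb]
    have e1 := integral_mul_sq_le hf.nonneg hM hGi
    have e2 := integral_mul_sq_le hf.isDensity_prodMarginals.nonneg (hf.prodMarginals_le h1 h2) hGi
    have e3 : (M + M₁ * M₂) * ∫ z, G z ^ 2 ≤ (M + M₁ * M₂) * hsicMeasure h f := by gcongr
    linarith
  have hk : ∀ x, ∫ u, K x u.1 ^ 2 ∂ν ≤ M₁ * (h ^ p)⁻¹ := fun x => by
    obtain ⟨hi, hle⟩ := integral_sq_gaussKernel_le hh x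
    rw [hf.integral_comp_fst (φ := fun x' => K x x' ^ 2)
      ((hKm.comp measurable_prodMk_left).pow_const 2) fun x' => by
        rw [abs_pow, abs_of_nonneg (hKb x x').1]
        exact pow_le_pow_left₀ (hKb x x').1 (hKb x x').2 2]
    calc ∫ x', marginalFst f x' * K x x' ^ 2 ≤ ∫ x', M₁ * K x x' ^ 2 := by
          refine integral_mono_of_nonneg (Filter.Eventually.of_forall fun x' =>
            mul_nonneg (hf.marginalFst_nonneg _) (sq_nonneg _)) (hi.const_mul _) ?_
          filter_upwards [h1] with x' hx'
          exact mul_le_mul_of_nonneg_right hx' (sq_nonneg _)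
      _ ≤ M₁ * (h ^ p)⁻¹ := by
          rw [integral_const_mul]
          gcongr
  have hl : ∀ y, ∫ u, L y u.2 ^ 2 ∂ν ≤ M₂ * (h ^ q)⁻¹ := fun y => by
    obtain ⟨hi, hle⟩ := integral_sq_gaussKernel_le hh y
    rw [hf.integral_comp_snd (φ := fun y' => L y y' ^ 2)
      ((hLm.comp measurable_prodMk_left).pow_const 2) fun y' => by
        rw [abs_pow, abs_of_nonneg (hLb y y').1]
        exact pow_le_pow_left₀ (hLb y y').1 (hLb y y').2 2]
    calc ∫ y', marginalSnd f y' * L y y' ^ 2 ≤ ∫ y', M₂ * L y y' ^ 2 := by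
          refine integral_mono_of_nonneg (Filter.Eventually.of_forall fun y' =>
            mul_nonneg (hf.marginalSnd_nonneg _) (sq_nonneg _)) (hi.const_mul _) ?_
          filter_upwards [h2] with y' hy'
          exact mul_le_mul_of_nonneg_right hy' (sq_nonneg _)
      _ ≤ M₂ * (h ^ q)⁻¹ := by
          rw [integral_const_mul]
          gcongr
  have hc : ∀ x y, ∫ u, K x u.1 ^ 2 * L y u.2 ^ 2 ∂ν ≤ M * ((h ^ p)⁻¹ * (h ^ q)⁻¹) :=
    fun x y => by
      obtain ⟨hi, hle⟩ := integral_sq_gaussKernel_le hh x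
      obtain ⟨hi', hle'⟩ := integral_sq_gaussKernel_le hh y
      have hprod : Integrable fun u : E p × E q => (K x u.1 * L y u.2) ^ 2 := by
        simp only [mul_pow]
        exact Integrable.mul_prod (μ := volume) (ν := volume) hi hi'
      simp only [← mul_pow]
      rw [hf.integral_densityMeasure]
      refine (integral_mul_sq_le hf.nonneg hM hprod).trans ?_
      simp only [mul_pow]
      have e := integral_prod_mul (μ := volume) (ν := volume) (fun x' => K x x' ^ 2)
        fun y' => L y y' ^ 2
      rw [show (∫ u : E p × E q, K x u.1 ^ 2 * L y u.2 ^ 2) =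
        (∫ x', K x x' ^ 2) * ∫ y', L y y' ^ 2 from e]
      exact mul_le_mul_of_nonneg_left (mul_le_mul hle hle'
        (integral_nonneg fun _ => sq_nonneg _) (by positivity)) hM0
  have hw2 : ∫ a, ∫ b, quadKernel K L a b ^ 2 ∂(ν.prod ν) ∂(ν.prod ν) ≤
      8 * (M + M₁ * M₂) * (h ^ (p + q))⁻¹ := by
    have hpt : ∀ a, ∫ b, quadKernel K L a b ^ 2 ∂(ν.prod ν) ≤
        8 * (M + M₁ * M₂) * (h ^ (p + q))⁻¹ := fun a => by
      refine (integral_sq_quadKernel_le ν hKm hLm hKb hLb hk hl hc a).trans_eq ?_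
      rw [pow_add, mul_inv]
      ring
    calc _ ≤ ∫ _a : (E p × E q) × (E p × E q), 8 * (M + M₁ * M₂) * (h ^ (p + q))⁻¹
          ∂(ν.prod ν) :=
          integral_mono_of_nonneg (Filter.Eventually.of_forall fun a =>
            integral_nonneg fun b => sq_nonneg _) (integrable_const _)
            (Filter.Eventually.of_forall hpt)
      _ = _ := by simp
  have hmain := HSIC.integral_sq_hsicStat_sub_le (n := n) (m := m) (lam := fun _ : Fin p => h)
    (mu := fun _ : Fin q => h) ν (fun _ => hh) (fun _ => hh) hm hmn
  rw [hf.integral_integral_quadKernel_eq hh] at hmain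
  refine hmain.trans ?_
  calc _ ≤ 2 * (m : ℝ)⁻¹ * (2 * ((M + M₁ * M₂) * hsicMeasure h f)) +
        (m : ℝ)⁻¹ ^ 2 * (8 * (M + M₁ * M₂) * (h ^ (p + q))⁻¹) := by gcongr
    _ = _ := by ring

end isotropic

/-! ### Critical value and error of the second kind by Chebyshev's inequality -/

section tests

variable {p q : ℕ} {f : E p × E q → ℝ} {h : ℝ} {n : ℕ}

lemma measurable_hsicStat_and_bounded (hh : 0 < h) (hn : 4 ≤ n) :
    Measurable (hsicStat (n := n) (fun _ : Fin p => h) fun _ : Fin q => h) ∧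
      ∀ z, |hsicStat (n := n) (fun _ : Fin p => h) (fun _ : Fin q => h) z| ≤
        (∏ _i : Fin p, h)⁻¹ * (∏ _j : Fin q, h)⁻¹ := by
  have hrep := fun z : Fin n → E p × E q =>
    hsicStat_eq_perm_average_quadKernel (fun _ : Fin p => h) (fun _ : Fin q => h) z
    (⟨0, by omega⟩ : Fin n) ⟨1, by omega⟩ ⟨2, by omega⟩ ⟨3, by omega⟩ (by simp) (by simp)
    (by simp) (by simp) (by simp) (by simp)
  have hw := measurable_quadKernel (measurable_gaussKernel fun _ : Fin p => h)
    (measurable_gaussKernel fun _ : Fin q => h)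
  constructor
  · rw [funext hrep]
    refine Measurable.const_mul (Finset.measurable_fun_sum _ fun σ _ => ?_) _
    exact hw.comp (g := Function.uncurry (quadKernel (gaussKernel fun _ : Fin p => h)
      (gaussKernel fun _ : Fin q => h))) (f := fun z : Fin n → E p × E q =>
      ((z (σ ⟨0, by omega⟩), z (σ ⟨1, by omega⟩)), (z (σ ⟨2, by omega⟩), z (σ ⟨3, by omega⟩))))
      (by fun_prop)
  · intro z
    have hn0 : (0 : ℝ) < n.factorial := by exact_mod_cast n.factorial_pos
    rw [hrep, abs_mul, abs_of_pos (inv_pos.2 hn0), inv_mul_le_iff₀ hn0]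
    refine (Finset.abs_sum_le_sum_abs _ _).trans ?_
    refine (Finset.sum_le_sum fun σ _ => abs_quadKernel_le
      (fun x y => ⟨gaussKernel_nonneg (fun _ => hh) x y, gaussKernel_le (fun _ => hh) x y⟩)
      (fun x y => ⟨gaussKernel_nonneg (fun _ => hh) x y, gaussKernel_le (fun _ => hh) x y⟩)
      _ _).trans_eq ?_
    simp [Fintype.card_perm]

lemma IsDensity.isProbabilityMeasure_sampleLaw (hf : IsDensity f) :
    IsProbabilityMeasure (sampleLaw n f) := by
  have := hf.isProbabilityMeasure
  exact inferInstanceAs (IsProbabilityMeasure (Measure.pi fun _ : Fin n => densityMeasure f))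

/-- Chebyshev's inequality around an arbitrary centre. -/
lemma measure_le_abs_sub_le {Ω : Type*} [MeasurableSpace Ω] {μ : Measure Ω} [IsProbabilityMeasure μ]
    {X : Ω → ℝ} {B c t v : ℝ} (hX : Measurable X) (hB : ∀ ω, |X ω| ≤ B) (ht : 0 < t)
    (hv : ∫ ω, (X ω - c) ^ 2 ∂μ ≤ v) :
    μ {ω | t ≤ |X ω - c|} ≤ ENNReal.ofReal (v / t ^ 2) := by
  have hi : Integrable (fun ω => (X ω - c) ^ 2) μ :=
    integrable_of_abs_le (B := (B + |c|) ^ 2) (by fun_prop) fun ω => by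
      rw [abs_pow]
      gcongr
      exact (abs_sub _ _).trans (by gcongr; exact hB ω)
  have hmk := mul_meas_ge_le_integral_of_nonneg
    (Filter.Eventually.of_forall fun ω => sq_nonneg (X ω - c)) hi (t ^ 2)
  have hset : {ω | t ≤ |X ω - c|} = {ω | t ^ 2 ≤ (X ω - c) ^ 2} := by
    ext ω
    simp only [Set.mem_ofPred_eq]
    rw [← sq_abs (X ω - c), pow_le_pow_iff_left₀ ht.le (abs_nonneg _) two_ne_zero]
  rw [hset, ← ofReal_measureReal]
  refine ENNReal.ofReal_le_ofReal ?_
  rw [le_div_iff₀ (by positivity)]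
  linarith

/-- An upper bound for the critical value, from the second moment under independence. -/
lemma nullQuantile_le (hf : IsDensity f) (hh : 0 < h) (hn : 4 ≤ n) {α t v : ℝ} (hα : 0 ≤ α)
    (ht : 0 < t)
    (hv : ∫ z, hsicStat (fun _ => h) (fun _ => h) z ^ 2 ∂(sampleLaw n (prodMarginals f)) ≤ v)
    (hvt : v / t ^ 2 ≤ α) :
    nullQuantile n (fun _ => h) (fun _ => h) α f ≤ t := by
  obtain ⟨hm, hB⟩ := measurable_hsicStat_and_bounded (p := p) (q := q) hh hn
  have := hf.isDensity_prodMarginals.isProbabilityMeasure_sampleLaw (n := n)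
  set H : (Fin n → E p × E q) → ℝ := hsicStat (fun _ => h) fun _ => h
  set μ := sampleLaw n (prodMarginals f)
  have hmem : t ∈ {t : ℝ | ENNReal.ofReal (1 - α) ≤ μ {z | H z ≤ t}} := by
    have hcheb : μ {z | t ≤ |H z - 0|} ≤ ENNReal.ofReal (v / t ^ 2) :=
      measure_le_abs_sub_le hm hB ht (by simpa using hv)
    have hcompl : μ {z | H z ≤ t}ᶜ ≤ ENNReal.ofReal α := by
      refine (measure_mono fun z hz => ?_).trans (hcheb.trans (ENNReal.ofReal_le_ofReal hvt))
      simp only [Set.mem_compl_iff, Set.mem_ofPred_eq, not_le, sub_zero] at hz ⊢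
      exact hz.le.trans (le_abs_self _)
    have hms : MeasurableSet {z | H z ≤ t} := measurableSet_le hm measurable_const
    rw [Set.mem_ofPred_eq, ENNReal.ofReal_sub _ hα, ENNReal.ofReal_one]
    refine tsub_le_iff_right.2 ?_
    rw [← prob_add_prob_compl (μ := μ) hms]
    gcongr
  unfold nullQuantile
  -- Boundedness below need not be proved: otherwise the infimum is 0 by convention, and t is
  -- positive.
  by_cases hbdd : BddBelow {t : ℝ | ENNReal.ofReal (1 - α) ≤ μ {z | H z ≤ t}}
  · exact csInf_le hbdd hmem
  · rw [Real.sInf_of_not_bddBelow hbdd]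
    exact ht.le

/-- An upper bound for the error of the second kind of the test. -/
lemma sampleLaw_hsicTest_eq_zero_le (hf : IsDensity f) (hh : 0 < h) (hn : 4 ≤ n) {α t v : ℝ}
    (hq : nullQuantile n (fun _ => h) (fun _ => h) α f ≤ t) (ht : t < hsicMeasure h f)
    (hv : ∫ z, (hsicStat (fun _ => h) (fun _ => h) z - hsicMeasure h f) ^ 2 ∂(sampleLaw n f) ≤ v) :
    sampleLaw n f {z | hsicTest n (fun _ => h) (fun _ => h) α f z = 0} ≤
      ENNReal.ofReal (v / (hsicMeasure h f - t) ^ 2) := by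
  obtain ⟨hm, hB⟩ := measurable_hsicStat_and_bounded (p := p) (q := q) hh hn
  have := hf.isProbabilityMeasure_sampleLaw (n := n)
  refine (measure_mono fun z hz => ?_).trans
    (measure_le_abs_sub_le hm hB (sub_pos.2 ht) hv)
  -- Acceptance means that the statistic is at most the critical value, hence at most t, and so
  -- deviates from its mean by at least θ − t.
  have hle : hsicStat (fun _ => h) (fun _ => h) z ≤ t := by
    by_contra hlt
    have hmem : z ∈ {w | nullQuantile n (fun _ : Fin p => h) (fun _ : Fin q => h) α f <
        hsicStat (fun _ => h) (fun _ => h) w} := hq.trans_lt (not_le.1 hlt)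
    simp only [Set.mem_ofPred_eq, hsicTest, Set.indicator_of_mem hmem] at hz
    exact one_ne_zero hz
  simp only [Set.mem_ofPred_eq]
  rw [abs_sub_comm]
  exact le_trans (by linarith) (le_abs_self _)

end tests

/-! ### Uniform control of the error over the Sobolev class -/

section classes

variable {p q : ℕ} {f : E p × E q → ℝ} {δ R R' : ℝ}

lemma ae_le_of_eLpNorm_top_le {α : Type*} [MeasurableSpace α] {μ : Measure α} {g : α → ℝ} {M : ℝ}
    (hM : 0 ≤ M) (hg : eLpNorm g ∞ μ ≤ ENNReal.ofReal M) : ∀ᵐ x ∂μ, g x ≤ M := by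
  rw [eLpNorm_exponent_top] at hg
  filter_upwards [enorm_ae_le_eLpNormEssSup g μ] with x hx
  have h1 := hx.trans hg
  rw [← ofReal_norm, ENNReal.ofReal_le_ofReal_iff hM] at h1
  exact (le_abs_self _).trans h1

lemma IsDensity.measurable_dependence (hf : IsDensity f) : Measurable (dependence f) :=
  hf.measurable.sub hf.isDensity_prodMarginals.measurable

lemma IsDensity.eLpNorm_dependence (hf : IsDensity f) (hs2 : MemLp (dependenceSum f) 2 volume) :
    eLpNorm (dependence f) 2 volume = ENNReal.ofReal (Real.sqrt (∫ w, dependenceSum f w ^ 2)) := by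
  have h1 := eLpNorm_comp_measurePreserving (p := 2)
    hf.measurable_dependence.aestronglyMeasurable (measurePreserving_finAddEquivProd)
  rw [← h1, show dependence f ∘ EuclideanSpace.finAddEquivProd = dependenceSum f from rfl,
    eLpNorm_two_eq_sqrt hs2]
  simp

/-- The dependence of a bounded density is bounded in `L²`. -/
lemma IsDensity.integral_sq_dependenceSum_le (hf : IsDensity f) {M M' : ℝ}
    (hM : ∀ᵐ z, f z ≤ M) (hM' : ∀ᵐ z, prodMarginals f z ≤ M') :
    ∫ w, dependenceSum f w ^ 2 ≤ 2 * (M + M') := by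
  have hi : Integrable fun z => M * f z + M' * prodMarginals f z :=
    (hf.integrable.const_mul M).fun_add (hf.integrable_prodMarginals.const_mul M')
  have e : ∫ w, dependenceSum f w ^ 2 = ∫ z, dependence f z ^ 2 :=
    integral_comp_finAddEquivProd fun z => dependence f z ^ 2
  calc ∫ w, dependenceSum f w ^ 2 ≤ ∫ z, 2 * (M * f z + M' * prodMarginals f z) := by
        rw [e]
        refine integral_mono_of_nonneg (Filter.Eventually.of_forall fun z => sq_nonneg _)
          (hi.const_mul 2) ?_
        filter_upwards [hM, hM'] with z hz hz'
        have h1 := mul_le_mul_of_nonneg_right hz (hf.nonneg z)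
        have h2 := mul_le_mul_of_nonneg_right hz' (hf.isDensity_prodMarginals.nonneg z)
        simp only [dependence]
        nlinarith [sq_nonneg (f z + prodMarginals f z)]
    _ = 2 * (M + M') := by
        rw [integral_const_mul, integral_add (hf.integrable.const_mul M)
          (hf.integrable_prodMarginals.const_mul M'), integral_const_mul, integral_const_mul,
          hf.integral_eq_one, hf.integral_prodMarginals]
        ring

lemma hsicMeasure_prodMarginals (hf : IsDensity f) (h : ℝ) :
    hsicMeasure h (prodMarginals f) = 0 := by
  have : dependenceSum (prodMarginals f) = 0 := by
    ext w
    simp [dependenceSum, hf.dependence_prodMarginals]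
  simp [hsicMeasure, this]

/-- The choice is m = ⌊n/4⌋, as a two-sample U-statistic uses 4m observations. For n ≥ 4 one has n ≤
7m, with equality at n = 7; this is the source of 7 and of 49 = 7². -/
lemma exists_block_length {n : ℕ} (d : ℕ) {N h : ℝ} (hn : 4 ≤ n) (hN : 0 < N) (hNn : N ≤ n)
    (hh : 0 < h) (hNh : (n : ℝ) ^ 2 * h ^ d = N ^ 2) :
    ∃ m : ℕ, 0 < m ∧ 4 * m ≤ n ∧ (m : ℝ)⁻¹ ≤ 7 * N⁻¹ ∧
      (m : ℝ)⁻¹ ^ 2 * (h ^ d)⁻¹ ≤ 49 * N⁻¹ ^ 2 := by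
  have hn0 : (0 : ℝ) < n := by exact_mod_cast (by omega : 0 < n)
  have hm7 : (n : ℝ) ≤ 7 * (n / 4 : ℕ) := by exact_mod_cast (by omega : n ≤ 7 * (n / 4))
  have hm0 : 0 < n / 4 := by omega
  have hm0' : (0 : ℝ) < (n / 4 : ℕ) := by exact_mod_cast hm0
  have hminv : ((n / 4 : ℕ) : ℝ)⁻¹ ≤ 7 * (n : ℝ)⁻¹ := by
    rw [← div_eq_mul_inv, inv_eq_one_div, div_le_div_iff₀ hm0' hn0]
    linarith
  refine ⟨n / 4, hm0, by omega,
    hminv.trans (mul_le_mul_of_nonneg_left (inv_anti₀ hN hNn) (by norm_num)), ?_⟩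
  calc ((n / 4 : ℕ) : ℝ)⁻¹ ^ 2 * (h ^ d)⁻¹ ≤ (7 * (n : ℝ)⁻¹) ^ 2 * (h ^ d)⁻¹ := by gcongr
    _ = 49 * ((n : ℝ) ^ 2 * h ^ d)⁻¹ := by
        rw [mul_inv, mul_pow, inv_pow]; ring
    _ = 49 * N⁻¹ ^ 2 := by rw [hNh, inv_pow]

/-- Since 1/N ≤ θ/B, and 1/N ≤ θ because B ≥ 1, the numerator is at most (28 + 392) D θ²/B = 420 D
θ²/B. As B ≥ 2a, the denominator is at least θ²/4. Hence the ratio is at most 1680 D/B, which B ≥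
1680 D/β makes at most β. -/
lemma chebyshev_ratio_le {β D B N θ a μ κ : ℝ} (hβ : 0 < β) (hD : 0 < D) (ha : 0 < a) (hN : 0 < N)
    (hB : 1 + 2 * a + 1680 * D / β ≤ B) (hθB : B * N⁻¹ ≤ θ) (hμ : μ ≤ 7 * N⁻¹)
    (hκ : κ ≤ 49 * N⁻¹ ^ 2) :
    a * N⁻¹ < θ ∧ (4 * D * μ * θ + 8 * D * κ) / (θ - a * N⁻¹) ^ 2 ≤ β := by
  have hNi : 0 < N⁻¹ := inv_pos.2 hN
  have hDβ : 0 < 1680 * D / β := by positivity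
  have hB0 : 0 < B := by linarith
  have hθ0 : 0 < θ := lt_of_lt_of_le (by positivity) hθB
  have hθa : 2 * (a * N⁻¹) ≤ θ := by
    refine le_trans ?_ hθB
    rw [← mul_assoc]
    gcongr
    linarith
  have haN : 0 < a * N⁻¹ := by positivity
  have hlt : a * N⁻¹ < θ := by linarith
  refine ⟨hlt, ?_⟩
  have hpos : 0 < θ - a * N⁻¹ := by linarith
  rw [div_le_iff₀ (by positivity)]
  have hx : N⁻¹ ≤ θ / B := by rw [le_div_iff₀ hB0]; linarith
  have hBD : 1680 * D ≤ β * B := by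
    have : 1680 * D / β ≤ B := by linarith
    rwa [div_le_iff₀ hβ, mul_comm B β] at this
  calc 4 * D * μ * θ + 8 * D * κ ≤ 4 * D * (7 * N⁻¹) * θ + 8 * D * (49 * N⁻¹ ^ 2) := by gcongr
    _ ≤ 4 * D * (7 * (θ / B)) * θ + 8 * D * (49 * ((θ / B) * θ)) := by
        have h1 : N⁻¹ ≤ θ := hx.trans (div_le_self hθ0.le (by linarith))
        rw [sq]
        gcongr
    _ = 420 * D / B * θ ^ 2 := by ring
    _ ≤ β / 4 * θ ^ 2 := by
        refine mul_le_mul_of_nonneg_right ?_ (sq_nonneg θ)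
        rw [div_le_iff₀ hB0]
        linarith
    _ ≤ β * (θ - a * N⁻¹) ^ 2 := by
        have h1 : (θ / 2) ^ 2 ≤ (θ - a * N⁻¹) ^ 2 := by
          gcongr
          linarith
        nlinarith

/-- The error of the second kind over the part of the Sobolev class at distance more than `r` from
independence, when `n √(h^(p+q)) = N` and `h^(2δ) = 1/N`. -/
lemma sampleLaw_hsicTest_eq_zero_le_of_mem_sobolevClass {α β B N h : ℝ} {n : ℕ} (hα : 0 < α)
    (hβ : 0 < β) (hδ : 0 < δ) (hR' : 0 < R') (hh : 0 < h) (hn : 4 ≤ n) (hN : 0 < N) (hNn : N ≤ n)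
    (hNh : (n : ℝ) ^ 2 * h ^ (p + q) = N ^ 2) (hhN : h ^ (2 * δ) = N⁻¹)
    (hB : 1 + 56 * R' / Real.sqrt α + 1680 * (R' + R' * R') / β ≤ B) (hf : IsDensity f)
    (hfc : f ∈ sobolevClass p q δ R R')
    (hr : (Real.exp (1 / 2) * B + R ^ 2) * N⁻¹ ≤ ∫ w, dependenceSum f w ^ 2) :
    sampleLaw n f {z | hsicTest n (fun _ => h) (fun _ => h) α f z = 0} ≤ ENNReal.ofReal β := by
  obtain ⟨hs, hsup⟩ := hfc
  have hs' : dependenceSum f ∈ sobolevBall (p + q) δ R := hs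
  have hs2 : MemLp (dependenceSum f) 2 volume := hs'.2.1
  have hM : ∀ᵐ z, f z ≤ R' :=
    ae_le_of_eLpNorm_top_le hR'.le ((le_max_left _ _).trans hsup)
  have hM1 : ∀ᵐ x, marginalFst f x ≤ R' := ae_le_of_eLpNorm_top_le hR'.le
    ((le_max_left _ _).trans ((le_max_right _ _).trans hsup))
  have hM2 : ∀ᵐ y, marginalSnd f y ≤ R' := ae_le_of_eLpNorm_top_le hR'.le
    ((le_max_right _ _).trans ((le_max_right _ _).trans hsup))
  have hM0 := hf.prodMarginals_le hM1 hM2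
  set θ := hsicMeasure h f with hθ
  set D := R' + R' * R' with hD
  have hD0 : 0 < D := by positivity
  have hsα : 0 < Real.sqrt α := Real.sqrt_pos.2 hα
  -- Under independence the second moment of the statistic is at most 8 · 2R'² · 49/N² = (28 R'/N)²,
  -- which equals α (a/N)², exactly what Chebyshev's inequality needs at level α.
  set a := 28 * R' / Real.sqrt α with ha
  have ha0 : 0 < a := by positivity
  have hB' : 1 + 2 * a + 1680 * D / β ≤ B := by
    refine le_trans (le_of_eq ?_) hB
    rw [ha]; ring
  have hDβ : 0 < 1680 * D / β := by positivity
  have hB0 : 0 < B := by linarith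
  have hn0 : (0 : ℝ) < n := by exact_mod_cast (by omega : 0 < n)
  -- the HSIC measure dominates its fluctuations
  have hθB : B * N⁻¹ ≤ θ := by
    have hsob := integral_sq_le_of_mem_sobolevBall hδ hh hs'
    rw [hhN] at hsob
    have : Real.exp (1 / 2) * (B * N⁻¹) ≤ Real.exp (1 / 2) * θ := by
      rw [hθ, hsicMeasure]
      linarith
    exact le_of_mul_le_mul_left this (Real.exp_pos _)
  obtain ⟨m, hm0, hmn, hminv, hsecond⟩ := exists_block_length (p + q) hn hN hNn hh hNh
  -- the critical value
  have hquant : nullQuantile n (fun _ => h) (fun _ => h) α f ≤ a * N⁻¹ := by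
    have hdep0 : MemLp (dependenceSum (prodMarginals f)) 2 volume := by
      have : dependenceSum (prodMarginals f) = 0 := by
        ext w
        simp [dependenceSum, hf.dependence_prodMarginals]
      rw [this]
      exact MemLp.zero
    have hv0 := hf.isDensity_prodMarginals.integral_sq_hsicStat_sub_le hh hdep0 hM0 (by positivity)
      (by rwa [hf.marginalFst_prodMarginals]) hR'.le (by rwa [hf.marginalSnd_prodMarginals]) hR'.le
      hm0 hmn
    simp only [hsicMeasure_prodMarginals hf, sub_zero, mul_zero, zero_add] at hv0
    refine nullQuantile_le hf hh hn hα.le (by positivity) hv0 ?_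
    rw [div_le_iff₀ (by positivity)]
    calc 8 * (R' * R' + R' * R') * ((m : ℝ)⁻¹ ^ 2 * (h ^ (p + q))⁻¹)
        ≤ 8 * (R' * R' + R' * R') * (49 * N⁻¹ ^ 2) := by gcongr
      _ = α * (a * N⁻¹) ^ 2 := by
          rw [mul_pow, ha, div_pow, mul_pow, Real.sq_sqrt hα.le]
          field_simp
          ring
  have hv := hf.integral_sq_hsicStat_sub_le hh hs2 hM hR'.le hM1 hR'.le hM2 hR'.le hm0 hmn
  obtain ⟨hlt, hfin⟩ := chebyshev_ratio_le hβ hD0 ha0 hN hB' hθB hminv hsecond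
  exact (sampleLaw_hsicTest_eq_zero_le hf hh hn hquant hlt hv).trans
    (ENNReal.ofReal_le_ofReal hfin)

end classes

/-! ### Arithmetic of the bandwidth -/

section bandwidth

variable {p q n : ℕ} {δ : ℝ}

lemma optBandwidth_pos (hn : 0 < n) : 0 < optBandwidth p q n δ :=
  Real.rpow_pos_of_pos (by exact_mod_cast hn) _

/-- Together with `optBandwidth_rpow` this is the balance behind the choice of bandwidth: with N = n
h^((p+q)/2), the stochastic scale 1/N equals the squared bias scale h^(2δ). -/
lemma sq_mul_optBandwidth_pow (hn : 0 < n) (hδ : 0 < δ) :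
    (n : ℝ) ^ 2 * optBandwidth p q n δ ^ (p + q) =
      ((n : ℝ) ^ (4 * δ / (4 * δ + p + q))) ^ 2 := by
  have hn0 : (0 : ℝ) < n := by exact_mod_cast hn
  have hd : (0 : ℝ) < 4 * δ + p + q := by positivity
  rw [optBandwidth, ← Real.rpow_natCast _ (p + q), ← Real.rpow_mul hn0.le,
    ← Real.rpow_natCast _ 2, ← Real.rpow_natCast _ 2, ← Real.rpow_mul hn0.le, ← Real.rpow_add hn0]
  congr 1
  push_cast
  field_simp
  ring

lemma optBandwidth_rpow (hn : 0 < n) (hδ : 0 < δ) :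
    optBandwidth p q n δ ^ (2 * δ) = ((n : ℝ) ^ (4 * δ / (4 * δ + p + q)))⁻¹ := by
  have hn0 : (0 : ℝ) < n := by exact_mod_cast hn
  have hd : (0 : ℝ) < 4 * δ + p + q := by positivity
  rw [optBandwidth, ← Real.rpow_mul hn0.le, ← Real.rpow_neg hn0.le]
  congr 1
  field_simp
  ring

/-- The product of n with the square root is N = n^(4δ/(4δ+p+q)), and the exponent 1 + (p+q)/(4δ) in
the hypothesis on n is the reciprocal of 4δ/(4δ+p+q). -/
lemma bandwidthCondition_optBandwidth {α : ℝ} (hp : 0 < p) (hq : 0 < q) (hδ : 0 < δ) (hα : 0 < α)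
    (hα' : α < 1 / Real.exp 1)
    (hn : Real.log (1 / α) ^ (1 + ((p : ℝ) + q) / (4 * δ)) < n) :
    1 < n ∧ BandwidthCondition n (fun _ : Fin p => optBandwidth p q n δ)
      (fun _ : Fin q => optBandwidth p q n δ) α := by
  have hlog : 1 < Real.log (1 / α) := by
    rw [Real.lt_log_iff_exp_lt (by positivity), lt_one_div (Real.exp_pos _) hα]
    exact hα'
  have hn1 : (1 : ℝ) < n := lt_of_le_of_lt (Real.one_le_rpow hlog.le (by positivity)) hn
  have hn1' : 1 < n := by exact_mod_cast hn1
  have hn0 : (0 : ℝ) < n := by linarith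
  have hd : (0 : ℝ) < 4 * δ + p + q := by positivity
  have hh0 := optBandwidth_pos (p := p) (q := q) (δ := δ) (by omega : 0 < n)
  have hh1 : optBandwidth p q n δ < 1 :=
    Real.rpow_lt_one_of_one_lt_of_neg hn1 (div_neg_of_neg_of_pos (by norm_num) hd)
  refine ⟨hn1', ?_, ?_, hlog⟩
  · simp only [Finset.prod_const, Finset.card_univ, Fintype.card_fin]
    exact max_lt (pow_lt_one₀ hh0.le hh1 hp.ne') (pow_lt_one₀ hh0.le hh1 hq.ne')
  · simp only [Finset.prod_const, Finset.card_univ, Fintype.card_fin]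
    have hN : (n : ℝ) * Real.sqrt (optBandwidth p q n δ ^ p * optBandwidth p q n δ ^ q) =
        (n : ℝ) ^ (4 * δ / (4 * δ + p + q)) := by
      rw [← pow_add, ← Real.sqrt_sq hn0.le, ← Real.sqrt_mul (sq_nonneg _), Real.sqrt_sq hn0.le,
        sq_mul_optBandwidth_pow (by omega) hδ, Real.sqrt_sq (by positivity)]
    rw [hN]
    have h1 := Real.rpow_lt_rpow (by positivity) hn
      (by positivity : 0 < 4 * δ / (4 * δ + p + q))
    rw [← Real.rpow_mul (by linarith)] at h1
    have h2 : (1 + ((p : ℝ) + q) / (4 * δ)) * (4 * δ / (4 * δ + p + q)) = 1 := by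
      field_simp
      ring
    rwa [h2, Real.rpow_one] at h1

end bandwidth

end HSIC

/-! ### The separation rate -/

theorem corollary2p2 (p q : ℕ) (hp : 0 < p) (hq : 0 < q) (α β δ R R' : ℝ)
    (hα : 0 < α) (hα' : α < 1 / Real.exp 1) (hβ : 0 < β) (hβ' : β < 1)
    (hδ : 0 < δ) (hR : 0 < R) (hR' : 0 < R') :
    ∃ C : ℝ, 0 < C ∧ ∀ n : ℕ,
      Real.log (1 / α) ^ (1 + ((p : ℝ) + q) / (4 * δ)) < n →
        HSIC.BandwidthCondition n (fun _ : Fin p => HSIC.optBandwidth p q n δ)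
          (fun _ : Fin q => HSIC.optBandwidth p q n δ) α ∧
        HSIC.separationRate
            (HSIC.hsicTest n (fun _ : Fin p => HSIC.optBandwidth p q n δ)
              (fun _ : Fin q => HSIC.optBandwidth p q n δ) α)
            (HSIC.sobolevClass p q δ R R') β ≤
          ENNReal.ofReal (C * (n : ℝ) ^ (-2 * δ / (4 * δ + p + q))) := by
  set B := 1 + 56 * R' / Real.sqrt α + 1680 * (R' + R' * R') / β with hB
  have hB0 : 0 < B := by positivity
  -- The first two terms turn ‖ψ‖² > S/N into θ ≥ B/N through the Sobolev bound. The last one serves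
  -- only to exclude alternatives when n < 4.
  set S := Real.exp (1 / 2) * B + R ^ 2 + 8 * (R' + R' * R') with hS
  have hS0 : 0 < S := by positivity
  refine ⟨Real.sqrt S, Real.sqrt_pos.2 hS0, fun n hn => ?_⟩
  obtain ⟨hn1, hbw⟩ := HSIC.bandwidthCondition_optBandwidth hp hq hδ hα hα' hn
  refine ⟨hbw, ?_⟩
  have hn0 : (0 : ℝ) < n := by exact_mod_cast (by omega : 0 < n)
  have hd : (0 : ℝ) < 4 * δ + p + q := by positivity
  set N := (n : ℝ) ^ (4 * δ / (4 * δ + p + q)) with hN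
  have hN0 : 0 < N := Real.rpow_pos_of_pos hn0 _
  have hNn : N ≤ n := by
    have h1 : 4 * δ / (4 * δ + p + q) ≤ 1 := by
      rw [div_le_one hd]
      have : (0 : ℝ) ≤ p + q := by positivity
      linarith
    calc N ≤ (n : ℝ) ^ (1 : ℝ) := Real.rpow_le_rpow_of_exponent_le (by exact_mod_cast hn1.le) h1
      _ = n := Real.rpow_one _
  set r := Real.sqrt S * (n : ℝ) ^ (-2 * δ / (4 * δ + p + q)) with hr
  have hr0 : 0 < r := mul_pos (Real.sqrt_pos.2 hS0) (Real.rpow_pos_of_pos hn0 _)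
  have hr2 : r ^ 2 = S * N⁻¹ := by
    rw [hr, mul_pow, Real.sq_sqrt hS0.le, hN, ← Real.rpow_neg hn0.le, ← Real.rpow_natCast _ 2,
      ← Real.rpow_mul hn0.le]
    congr 2
    push_cast
    field_simp
    ring
  unfold HSIC.separationRate
  -- It suffices that r itself is admissible in the infimum.
  refine iInf_le_of_le r (iInf_le_of_le hr0 (iInf_le_of_le ?_ le_rfl))
  refine iSup₂_le fun f hf => ?_
  obtain ⟨hfd, hfc, hfr⟩ := hf
  have hs2 : MemLp (HSIC.dependenceSum f) 2 volume := hfc.1.2.1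
  rw [hfd.eLpNorm_dependence hs2, ENNReal.ofReal_lt_ofReal_iff_of_nonneg hr0.le,
    Real.lt_sqrt hr0.le, hr2] at hfr
  have hNi : 0 < N⁻¹ := inv_pos.2 hN0
  rcases lt_or_ge n 4 with hn4 | hn4
  -- With fewer than four observations the representation by `quadKernel` is not available. But
  -- every density of the class has ‖ψ‖² ≤ 2(R' + R'²), whereas N ≤ 4 gives r² = S/N ≥ 8(R' +
  -- R'²)/4, so no alternative exists.
  · exfalso
    have hM := HSIC.ae_le_of_eLpNorm_top_le hR'.le ((le_max_left _ _).trans hfc.2)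
    have hM1 := HSIC.ae_le_of_eLpNorm_top_le hR'.le
      ((le_max_left _ _).trans ((le_max_right _ _).trans hfc.2))
    have hM2 := HSIC.ae_le_of_eLpNorm_top_le hR'.le
      ((le_max_right _ _).trans ((le_max_right _ _).trans hfc.2))
    have hle := hfd.integral_sq_dependenceSum_le hM (hfd.prodMarginals_le hM1 hM2)
    have hN4 : N ≤ 4 := hNn.trans (by exact_mod_cast hn4.le)
    have h1 : (4 : ℝ)⁻¹ ≤ N⁻¹ := inv_anti₀ hN0 hN4
    have h2 : 8 * (R' + R' * R') ≤ S := by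
      have : 0 < Real.exp (1 / 2) * B + R ^ 2 := by positivity
      linarith
    have h3 : 8 * (R' + R' * R') * (4 : ℝ)⁻¹ ≤ S * N⁻¹ := by gcongr
    linarith
  · refine HSIC.sampleLaw_hsicTest_eq_zero_le_of_mem_sobolevClass hα hβ hδ hR'
      (HSIC.optBandwidth_pos (by omega)) hn4 hN0 hNn
      (HSIC.sq_mul_optBandwidth_pow (by omega) hδ) (HSIC.optBandwidth_rpow (by omega) hδ) le_rfl
      hfd hfc (le_trans ?_ hfr.le)
    gcongr
    have : 0 < 8 * (R' + R' * R') := by positivity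
    linarith
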